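/- Let $K$ be an algebraically closed field of characteristic $2$, let $a\in K\setminus\{0,1\}$, and let \[F_{4,a}=(a_{ij})=\begin{pmatrix}0&1&0&0\\ a&0&1&0\\ 0&1&0&1\\ 0&0&1&0\end{pmatrix}.\] Let $\widetilde G(F_{4,a})$ be the Lie algebra over $K$ with generators $e_i,f_i,h_i$ ($1\le i\le 4$) and relations $[e_i,f_j]=\delta_{ij}h_j$, $[h_i,h_j]=0$, $[h_i,e_j]=a_{ij}e_j$, $[h_i,f_j]=-a_{ij}f_j$, with the $\mathbb Z$-grading given by $\deg e_i=1$, $\deg f_i=-1$, $\deg h_i=0$. Let $J$ be the largest homogeneous ideal of $\widetilde G(F_{4,a})$ that intersects the sum of the components of degrees $-1,0,1$ trivially, and let $G(F_{4,a})=\widetilde G(F_{4,a})/J$. Write $\bar h_i$ for the class of $h_i$ and $\mathfrak h=\operatorname{span}\{\bar h_1,\dots,\bar h_4\}$. A Lie $2$-algebra is a Lie algebra $\mathfrak g$ over $K$ with a map $x\mapsto x^{[2]}$ such that $(x+y)^{[2]}=x^{[2]}+y^{[2]}+[x,y]$, $(cx)^{[2]}=c^2x^{[2]}$ and $\operatorname{ad}(x^{[2]})=(\operatorname{ad}x)^2$;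 a torus in it is a subalgebra on which $[2]$ restricts to a bijection onto itself, and its toral rank is the maximal dimension of a torus. Then: (1) $G(F_{4,a})$ is a simple Lie algebra of dimension $34$ and it carries a $2$-map $[2]$, i.e. it is a simple Lie $2$-algebra. (2) The toral rank of $G(F_{4,a})$ is $4$. (3) $\mathfrak h$ is a Cartan subalgebra, and the subalgebra $T(\mathfrak h)$ generated by the elements $t\in\mathfrak h$ with $t^{[2]}=t$ is a $4$-dimensional torus with basis $\bar h_1,\ \tfrac1a(\bar h_2+\bar h_4),\ \bar h_3,\ \bar h_4$. Let $\alpha,\beta,\gamma,\lambda\in T(\mathfrak h)^*$ be the dual basis, let $\Gamma=\langle\alpha,\beta,\gamma,\lambda\rangle$ be the additive subgroup of $T(\mathfrak h)^*$ that it generates, and for $\xi\in\Gamma$ let $\mathfrak g_\xi=\{x\in G(F_{4,a}) : [t,x]=\xi(t)x\ \text{for all } t\in T(\mathfrak h)\}$. Then $\Gamma$ is an elementary abelian group of order $16$, $\mathfrak g_0=T(\mathfrak h)$, \[G(F_{4,a})=T(\mathfrak h)\oplus\bigoplus_{\xi\in\Gamma,\ \xi\ne0}\mathfrak g_\xi,\]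 and $\dim_K\mathfrak g_\xi=2$ for every nonzero $\xi\in\Gamma$. -/

import Mathlib

/-! ### Lie `2`-algebras, tori, toral rank -/

section TwoMap

variable (K : Type*) {L : Type*} [Field K] [LieRing L] [LieAlgebra K L]

/-- `P` is a `2`-map on the Lie algebra `L`, i.e. `(L, P)` is a Lie `2`-algebra. -/
structure IsTwoMap (P : L → L) : Prop where
  map_add : ∀ x y : L, P (x + y) = P x + P y + ⁅x, y⁆
  map_smul : ∀ (c : K) (x : L), P (c • x) = c ^ 2 • P x
  ad_map : ∀ x : L, LieAlgebra.ad K L (P x) = LieAlgebra.ad K L x ^ 2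

variable {K}

/-- A torus (toral subalgebra) of `(L, P)`: a Lie subalgebra on which the `2`-map is invertible,
that is, which the `2`-map sends bijectively onto itself. -/
def IsTorus (P : L → L) (t : LieSubalgebra K L) : Prop :=
  Set.BijOn P (t : Set L) (t : Set L)

variable (K)

/-- The toral rank of `(L, P)` is `n`: the maximum of the dimensions of its tori exists and
is `n`. -/
def HasToralRank (P : L → L) (n : ℕ) : Prop :=
  IsGreatest {d : ℕ | ∃ t : LieSubalgebra K L, IsTorus P t ∧ Module.finrank K t = d} n

variable {K}

/-- `T(h)`: the subalgebra generated by the toral elements (`P t = t`) of `h`. -/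
def toralPart (P : L → L) (h : LieSubalgebra K L) : LieSubalgebra K L :=
  LieSubalgebra.lieSpan K L {t : L | t ∈ h ∧ P t = t}

/-- The space of weight `ξ` of `L` with respect to `T`:
`{x | [t, x] = ξ(t) x for all t ∈ T}`. -/
def weightSubspace (T : LieSubalgebra K L) (ξ : Module.Dual K T) : Submodule K L where
  carrier := {x : L | ∀ t : T, ⁅(t : L), x⁆ = ξ t • x}
  add_mem' := by
    intro x y hx hy t
    rw [lie_add, hx t, hy t, smul_add]
  zero_mem' := by
    intro t
    rw [lie_zero, smul_zero]
  smul_mem' := by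
    intro c x hx t
    rw [lie_smul, hx t, smul_comm]

open scoped Classical in
/-- The decomposition `L = T ⊕ ⨁_{ξ ∈ Γ, ξ ≠ 0} L_ξ` into weight spaces with respect to `T`:
`L` is the internal direct sum of its weight spaces `L_ξ`, `ξ ∈ Γ`, and `L_0 = T`. -/
def IsCartanDecomposition (T : LieSubalgebra K L) (Γ : AddSubgroup (Module.Dual K T)) : Prop :=
  weightSubspace T 0 = T.toSubmodule ∧
    DirectSum.IsInternal (fun ξ : Γ => weightSubspace T (ξ : Module.Dual K T))

end TwoMap

/-! ### Contragredient Lie algebras -/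

noncomputable section

namespace Contragredient

/-- The generators `e i`, `f i`, `h i`. -/
inductive Gen (ι : Type*)
  | e : ι → Gen ι
  | f : ι → Gen ι
  | h : ι → Gen ι

variable {K ι : Type*} [Field K] [DecidableEq ι] (A : Matrix ι ι K)

/-- The defining relations `[e_i, f_j] = δ_ij h_j`, `[h_i, h_j] = 0`, `[h_i, e_j] = a_ij e_j`,
`[h_i, f_j] = - a_ij f_j`. -/
inductive IsRelator : FreeLieAlgebra K (Gen ι) → Prop
  | ef (i j : ι) : IsRelator
      (⁅FreeLieAlgebra.of K (Gen.e i), FreeLieAlgebra.of K (Gen.f j)⁆ -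
        (if i = j then FreeLieAlgebra.of K (Gen.h j) else 0))
  | hh (i j : ι) : IsRelator ⁅FreeLieAlgebra.of K (Gen.h i), FreeLieAlgebra.of K (Gen.h j)⁆
  | he (i j : ι) : IsRelator
      (⁅FreeLieAlgebra.of K (Gen.h i), FreeLieAlgebra.of K (Gen.e j)⁆ -
        A i j • FreeLieAlgebra.of K (Gen.e j))
  | hf (i j : ι) : IsRelator
      (⁅FreeLieAlgebra.of K (Gen.h i), FreeLieAlgebra.of K (Gen.f j)⁆ +
        A i j • FreeLieAlgebra.of K (Gen.f j))

/-- The ideal of the free Lie algebra generated by the relations. -/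
def relationIdeal : LieIdeal K (FreeLieAlgebra K (Gen ι)) :=
  LieSubmodule.lieSpan K (FreeLieAlgebra K (Gen ι)) {x | IsRelator A x}

/-- The Lie algebra `G̃(A)` presented by the generators and relations above. -/
abbrev Tilde : Type _ := FreeLieAlgebra K (Gen ι) ⧸ relationIdeal A

/-- The image of a generator in `G̃(A)`. -/
def Tilde.gen (x : Gen ι) : Tilde A :=
  LieSubmodule.Quotient.mk' (relationIdeal A) (FreeLieAlgebra.of K x)

/-- Iterated brackets of generators, with their degree for
`deg e_i = 1`, `deg f_i = -1`, `deg h_i = 0`. -/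
inductive IsMonomial : ℤ → Tilde A → Prop
  | e (i : ι) : IsMonomial 1 (Tilde.gen A (Gen.e i))
  | f (i : ι) : IsMonomial (-1) (Tilde.gen A (Gen.f i))
  | h (i : ι) : IsMonomial 0 (Tilde.gen A (Gen.h i))
  | lie {m n : ℤ} {x y : Tilde A} : IsMonomial m x → IsMonomial n y → IsMonomial (m + n) ⁅x, y⁆

/-- The homogeneous component `G̃(A)_n` of the `ℤ`-grading of `G̃(A)`. -/
def component (n : ℤ) : Submodule K (Tilde A) :=
  Submodule.span K {x | IsMonomial A n x}

/-- An ideal of `G̃(A)` is homogeneous if it is the sum of its intersections with the homogeneous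
components. -/
def IsHomogeneousIdeal (I : LieIdeal K (Tilde A)) : Prop :=
  I.toSubmodule = ⨆ n : ℤ, I.toSubmodule ⊓ component A n

/-- The local part `G̃(A)_{-1} ⊕ G̃(A)_0 ⊕ G̃(A)_1`. -/
def localPart : Submodule K (Tilde A) :=
  component A (-1) ⊔ component A 0 ⊔ component A 1

/-- The homogeneous ideals of `G̃(A)` which intersect the local part trivially. -/
def admissibleIdeals : Set (LieIdeal K (Tilde A)) :=
  {I | IsHomogeneousIdeal A I ∧ I.toSubmodule ⊓ localPart A = ⊥}

/-- `J(A)`: the largest homogeneous ideal of `G̃(A)` which intersects the local part trivially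
(see `radical_isGreatest`). -/
def radical : LieIdeal K (Tilde A) := sSup (admissibleIdeals A)

section WellDefined

open scoped TensorProduct

/-- The element `t ^ n ⊗ x` of the loop algebra of `G̃(A)`. -/
def loopMonomial (n : ℤ) (x : Tilde A) : LieAlgebra.loopAlgebra K ℤ (Tilde A) :=
  AddMonoidAlgebra.single n (1 : K) ⊗ₜ[K] x

theorem loopMonomial_lie (m n : ℤ) (x y : Tilde A) :
    ⁅loopMonomial A m x, loopMonomial A n y⁆ = loopMonomial A (m + n) ⁅x, y⁆ := by
  rw [loopMonomial, loopMonomial, loopMonomial, LieAlgebra.ExtendScalars.bracket_tmul,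
    AddMonoidAlgebra.single_mul_single, mul_one]

theorem Tilde.gen_ef (i j : ι) : ⁅Tilde.gen A (Gen.e i), Tilde.gen A (Gen.f j)⁆ =
    if i = j then Tilde.gen A (Gen.h j) else 0 := by
  have h : LieSubmodule.Quotient.mk' (relationIdeal A) _ = 0 :=
    (LieSubmodule.Quotient.mk_eq_zero' (N := relationIdeal A)).2
      (LieSubmodule.subset_lieSpan (IsRelator.ef (A := A) i j))
  rw [map_sub, sub_eq_zero] at h
  split_ifs at h ⊢ with hij
  · exact h
  · exact h.trans (map_zero _)

theorem Tilde.gen_hh (i j : ι) : ⁅Tilde.gen A (Gen.h i), Tilde.gen A (Gen.h j)⁆ = 0 :=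
  (LieSubmodule.Quotient.mk_eq_zero' (N := relationIdeal A)).2
    (LieSubmodule.subset_lieSpan (IsRelator.hh (A := A) i j))

theorem Tilde.gen_he (i j : ι) : ⁅Tilde.gen A (Gen.h i), Tilde.gen A (Gen.e j)⁆ =
    A i j • Tilde.gen A (Gen.e j) := by
  have h : LieSubmodule.Quotient.mk' (relationIdeal A) _ = 0 :=
    (LieSubmodule.Quotient.mk_eq_zero' (N := relationIdeal A)).2
      (LieSubmodule.subset_lieSpan (IsRelator.he (A := A) i j))
  rw [map_sub, sub_eq_zero, map_smul] at h
  exact h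

theorem Tilde.gen_hf (i j : ι) : ⁅Tilde.gen A (Gen.h i), Tilde.gen A (Gen.f j)⁆ =
    -(A i j • Tilde.gen A (Gen.f j)) := by
  have h : LieSubmodule.Quotient.mk' (relationIdeal A) _ = 0 :=
    (LieSubmodule.Quotient.mk_eq_zero' (N := relationIdeal A)).2
      (LieSubmodule.subset_lieSpan (IsRelator.hf (A := A) i j))
  rw [map_add, map_smul, add_eq_zero_iff_eq_neg] at h
  exact h

/-- The images of the generators in the loop algebra. -/
def loopGen : Gen ι → LieAlgebra.loopAlgebra K ℤ (Tilde A)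
  | Gen.e i => loopMonomial A 1 (Tilde.gen A (Gen.e i))
  | Gen.f i => loopMonomial A (-1) (Tilde.gen A (Gen.f i))
  | Gen.h i => loopMonomial A 0 (Tilde.gen A (Gen.h i))

theorem relationIdeal_le_ker :
    relationIdeal A ≤ (FreeLieAlgebra.lift K (loopGen A)).ker := by
  refine LieSubmodule.lieSpan_le.2 ?_
  intro x hx
  simp only [SetLike.mem_coe, LieHom.mem_ker]
  cases hx with
  | ef i j =>
    rw [map_sub, LieHom.map_lie, FreeLieAlgebra.lift_of_apply, FreeLieAlgebra.lift_of_apply]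
    simp only [loopGen, loopMonomial_lie, Tilde.gen_ef]
    split_ifs
    · simp [loopGen]
    · simp [loopMonomial]
  | hh i j =>
    simp only [LieHom.map_lie, FreeLieAlgebra.lift_of_apply, loopGen, loopMonomial_lie,
      Tilde.gen_hh]
    simp [loopMonomial]
  | he i j =>
    simp only [map_sub, LieHom.map_lie, map_smul, FreeLieAlgebra.lift_of_apply, loopGen,
      loopMonomial_lie, Tilde.gen_he]
    simp [loopMonomial]
  | hf i j =>
    simp only [map_add, LieHom.map_lie, map_smul, FreeLieAlgebra.lift_of_apply, loopGen,
      loopMonomial_lie, Tilde.gen_hf]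
    simp [loopMonomial, TensorProduct.tmul_neg]

/-- The homomorphism from `G̃(A)` to its loop algebra which sends a homogeneous `x` of degree `n`
to `t ^ n ⊗ x`. -/
def toLoop : Tilde A →ₗ[K] LieAlgebra.loopAlgebra K ℤ (Tilde A) :=
  (relationIdeal A).toSubmodule.liftQ
    (FreeLieAlgebra.lift K (loopGen A) : FreeLieAlgebra K (Gen ι) →ₗ[K] _)
    (fun _ hx => LinearMap.mem_ker.2 (LieHom.mem_ker.1 (relationIdeal_le_ker A hx)))

theorem toLoop_lie (x y : Tilde A) : toLoop A ⁅x, y⁆ = ⁅toLoop A x, toLoop A y⁆ := by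
  obtain ⟨x, rfl⟩ := LieSubmodule.Quotient.surjective_mk' (relationIdeal A) x
  obtain ⟨y, rfl⟩ := LieSubmodule.Quotient.surjective_mk' (relationIdeal A) y
  exact LieHom.map_lie (FreeLieAlgebra.lift K (loopGen A)) x y

theorem toLoop_gen (x : Gen ι) : toLoop A (Tilde.gen A x) = loopGen A x :=
  FreeLieAlgebra.lift_of_apply (R := K) (loopGen A) x

theorem toLoop_of_isMonomial {n : ℤ} {x : Tilde A} (hx : IsMonomial A n x) :
    toLoop A x = loopMonomial A n x := by
  induction hx with
  | e i => exact toLoop_gen A _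
  | f i => exact toLoop_gen A _
  | h i => exact toLoop_gen A _
  | lie _ _ hx hy => rw [toLoop_lie, hx, hy, loopMonomial_lie]

/-- The projection of `G̃(A)` onto its component of degree `n`. -/
def proj (n : ℤ) : Tilde A →ₗ[K] Tilde A :=
  Finsupp.lapply n ∘ₗ (LieAlgebra.LoopAlgebra.toFinsupp K ℤ (Tilde A)).toLinearMap ∘ₗ toLoop A

theorem proj_of_mem {m : ℤ} {x : Tilde A} (hx : x ∈ component A m) (n : ℤ) :
    proj A n x = if m = n then x else 0 := by
  induction hx using Submodule.span_induction with
  | mem x hx =>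
    have h : proj A n x = LieAlgebra.LoopAlgebra.toFinsupp K ℤ (Tilde A) (toLoop A x) n := rfl
    rw [h, toLoop_of_isMonomial A hx, loopMonomial,
      LieAlgebra.LoopAlgebra.toFinsupp_single_tmul, Finsupp.single_apply]
  | zero => simp
  | add x y _ _ hx hy => rw [map_add, hx, hy]; split_ifs <;> simp
  | smul c x _ hx => rw [map_smul, hx]; split_ifs <;> simp

theorem radical_toSubmodule :
    (radical A).toSubmodule = ⨆ I ∈ admissibleIdeals A, I.toSubmodule := by
  rw [radical, LieSubmodule.sSup_toSubmodule_eq_iSup]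

/-- `J(A)` is well defined: it is itself homogeneous with trivial intersection with the local
part, and it contains every other such ideal. -/
theorem radical_isGreatest : IsGreatest (admissibleIdeals A) (radical A) := by
  refine ⟨⟨?_, ?_⟩, fun I hI => le_sSup hI⟩
  · refine le_antisymm ?_ (iSup_le fun n => inf_le_left)
    conv_lhs => rw [radical_toSubmodule]
    refine iSup₂_le fun I hI => ?_
    rw [hI.1]
    refine iSup_mono fun n => inf_le_inf_right _ ?_
    exact (LieSubmodule.toSubmodule_le_toSubmodule _ _).2 (le_sSup hI)
  · have key : ∀ n : ℤ, component A n ≤ localPart A → ∀ x ∈ radical A, proj A n x = 0 := by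
      intro n hn
      have h : (radical A).toSubmodule ≤ LinearMap.ker (proj A n) := by
        rw [radical_toSubmodule]
        refine iSup₂_le fun I hI => ?_
        rw [hI.1]
        refine iSup_le fun m => ?_
        rintro x ⟨hxI, hxm⟩
        rw [LinearMap.mem_ker, proj_of_mem A hxm]
        split_ifs with hmn
        · subst hmn
          have : x ∈ I.toSubmodule ⊓ localPart A := ⟨hxI, hn hxm⟩
          rwa [hI.2, Submodule.mem_bot] at this
        · rfl
      exact fun x hx => h hx
    rw [eq_bot_iff]
    rintro x ⟨hxJ, hxl⟩
    obtain ⟨y, hy, c, hc, rfl⟩ := Submodule.mem_sup.1 hxl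
    obtain ⟨a, ha, b, hb, rfl⟩ := Submodule.mem_sup.1 hy
    have h1 := key (-1) (le_sup_left.trans le_sup_left) _ hxJ
    have h2 := key 0 (le_sup_right.trans le_sup_left) _ hxJ
    have h3 := key 1 le_sup_right _ hxJ
    simp only [map_add, proj_of_mem A ha, proj_of_mem A hb, proj_of_mem A hc] at h1 h2 h3
    norm_num at h1 h2 h3
    simp [h1, h2, h3]

end WellDefined

/-- The contragredient Lie algebra `G(A) = G̃(A) / J(A)` with Cartan matrix `A`. -/
abbrev G : Type _ := Tilde A ⧸ radical A

/-- The class of a generator in `G(A)`. -/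
def gen (x : Gen ι) : G A :=
  LieSubmodule.Quotient.mk' (radical A) (Tilde.gen A x)

theorem gen_hh (i j : ι) : ⁅gen A (Gen.h i), gen A (Gen.h j)⁆ = 0 := by
  have h := congrArg (LieSubmodule.Quotient.mk' (radical A)) (Tilde.gen_hh A i j)
  rw [map_zero] at h
  exact h

/-- The subalgebra `h = span {h_i}` of `G(A)`. -/
def cartan : LieSubalgebra K (G A) where
  __ := Submodule.span K (Set.range fun i => gen A (Gen.h i))
  lie_mem' := by
    intro x y hx hy
    have h : ⁅x, y⁆ = 0 := by
      induction hx, hy using Submodule.span_induction₂ with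
      | mem_mem x y hx hy =>
        obtain ⟨i, rfl⟩ := hx
        obtain ⟨j, rfl⟩ := hy
        exact gen_hh A i j
      | zero_left => simp
      | zero_right => simp
      | add_left x y z _ _ _ hx hy => rw [add_lie, hx, hy, add_zero]
      | add_right x y z _ _ _ hx hy => rw [lie_add, hx, hy, add_zero]
      | smul_left c x y _ _ h => rw [smul_lie, h, smul_zero]
      | smul_right c x y _ _ h => rw [lie_smul, h, smul_zero]
    rw [h]
    exact Submodule.zero_mem _

/-- The Cartan matrix `F_{4,a}`. -/
def F4 (a : K) : Matrix (Fin 4) (Fin 4) K :=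
  !![0, 1, 0, 0;
     a, 0, 1, 0;
     0, 1, 0, 1;
     0, 0, 1, 0]

end Contragredient

end

/-!
The algebra `G(F_{4,a})` is identified with an explicit algebra of dimension `34`, and its structure
is read off from the multiplication table.

Its `15` positive roots in `ℤ⁴` have pairwise distinct nonzero reductions modulo `2`. Hence the
basis consists of four toral elements and of a pair `e_v, f_v` for each nonzero `v` in `𝔽₂⁴`, and
the torus has the weight `v` on both `e_v` and `f_v`. All structure constants are in `𝔽₂[a]`, and
the Jacobi identity (`jacobi_table`) is a finite computation there. The resulting Lie algebra `Model
a` is simple (`isSimple`): every nonzero ideal contains a weight vector, hence a nonzero toral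
element because the coroots `[e_v, f_v]` are nonzero (their coefficients are products of powers of
`a` and `1 + a`), hence everything because the Dynkin diagram is connected.

The map `G̃(F_{4,a}) → Model a` is onto, graded, and injective on the local part, since the
triangular decomposition shows that the local part of `G̃(A)` is spanned by the generators
(`component_local`). So its kernel is contained in the radical, and by simplicity of the image it is
the radical (`radical_eq_ker`). This gives a basis of `G(F_{4,a})` with the given table
(`exists_isTableBasis`).

The `2`-map is the quadratic map that fixes the toral basis, kills the root vectors and has the
bracket as its polar form (`exists_isTwoMap`). For the toral rank, tori are abelian and spanned by
toral elements (Lang's theorem, `span_fixed_eq_top`), and a density argument along a line shows that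
no torus has a dimension larger than that of any centralizer (`IsTorus.finrank_le`); a regular
element of the Cartan subalgebra has a centralizer of dimension `4`.
-/

/-! ### The multiplication table -/

namespace WeisfeilerKac

open Module

/-- The positive root with reduction `v`: its coordinates in the simple roots are the decimal
digits, for example `1321` stands for `α₁ + 3α₂ + 2α₃ + α₄`. Here the reduction `v` is a number
below `16` whose bits `0, 1, 2, 3` are `r₂, r₁, r₂ + r₄, r₃` modulo `2`; these are the values of the
root `r₁α₁ + r₂α₂ + r₃α₃ + r₄α₄` on the toral elements `h₁, (h₂ + h₄) / a, h₃, h₄`, and the `15`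
positive roots have the `15` nonzero reductions. All digits are at most `3`, so no carry occurs and
adding two codes adds the roots. -/
def rootCode (v : ℕ) : ℕ :=
  [0, 2321, 1000, 1321, 1, 100, 1221, 1100, 10, 111, 1210, 1111, 11, 110, 1211, 1110].getD v 0

/-- The exponent of `a` in `n_v = a ^ expA v * (1 + a) ^ expB v`, the value on the pair `(e_v, f_v)`
of the invariant symmetric form normalized by `(e₁, f₁) = 1`. -/
def expA (v : ℕ) : ℕ := [0, 2, 0, 2, 1, 1, 1, 1, 1, 1, 1, 1, 1, 1, 1, 1].getD v 0

/-- The exponent of `1 + a` in `n_v`, see `expA`. -/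
def expB (v : ℕ) : ℕ := [0, 1, 0, 1, 0, 0, 1, 0, 0, 0, 1, 0, 0, 0, 1, 0].getD v 0

/-- The term `a ^ p * (1 + a) ^ q * b m`, for `q ≤ 1`, expanded into powers of `a`. Here and below,
a list of pairs `(d, m)` stands for the sum of the `a ^ d * b m`, with `b` the basis of the algebra.
-/
def monomial (p q : ℕ) (m : Fin 34) : List (ℕ × Fin 34) :=
  if q = 0 then [(p, m)] else [(p, m), (p + 1, m)]

/-- The reduction modulo `2` of the root of the basis vector `b i`, as a number below `16` (see
`rootCode`). The basis consists of the toral elements `h₁, (h₂ + h₄) / a, h₃, h₄` at the indices `0,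
1, 2, 3` (weight `0`, as subtraction and division truncate), and of `e_v` and `f_v` at the indices
`2v + 2` and `2v + 3` for `1 ≤ v ≤ 15`. -/
def weight (i : Fin 34) : ℕ := ((i : ℕ) - 2) / 2

/-- The index of `e_v` (`s = 0`) or `f_v` (`s = 1`). -/
def rootVec (v s : ℕ) : Fin 34 := Fin.ofNat 34 (2 * v + 2 + s)

/-- The bracket `[e_v, f_v]`. For `v = 2`, where `expA v - 1` truncates, bits `2` and `3` vanish. -/
def coroot (v : ℕ) : List (ℕ × Fin 34) :=
  (if v.testBit 1 then monomial (expA v) (expB v) 0 else []) ++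
  (if v.testBit 0 then monomial (expA v) (expB v) 1 else []) ++
  (if v.testBit 3 then monomial (expA v - 1) (expB v) 2 else []) ++
  (if v.testBit 2 then monomial (expA v - 1) (expB v) 3 else [])

/-- The bracket of two root vectors, in the form that invariance forces: `[e_v, e_w] = e_u` if `u =
v + w` is a root, `[e_v, f_v]` is the coroot, and `[e_v, f_w] = (n_v / n_u) e_u` if `v = w + u` as
roots; the other cases follow from the symmetry that exchanges `e` and `f`. Roots with `u = ±v ± w`
have reduction `v ^^^ w`. -/
def rootBracket (v s w t : ℕ) : List (ℕ × Fin 34) :=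
  let u := v ^^^ w
  if s = t then
    if rootCode v + rootCode w = rootCode u then [(0, rootVec u s)] else []
  else if v = w then coroot v
  else if rootCode w + rootCode u = rootCode v then
    monomial (expA v - expA u) (expB v - expB u) (rootVec u s)
  else if rootCode v + rootCode u = rootCode w then
    monomial (expA w - expA u) (expB w - expB u) (rootVec u t)
  else []

/-- The bracket `[b i, b j]` of two basis vectors. -/
def table (i j : Fin 34) : List (ℕ × Fin 34) :=
  if (i : ℕ) < 4 then
    if (weight j).testBit i then [(0, j)] else []
  else if (j : ℕ) < 4 then
    if (weight i).testBit j then [(0, i)] else []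
  else rootBracket (weight i) ((i : ℕ) % 2) (weight j) ((j : ℕ) % 2)

/-- The bracket of `b i` with the element given by a list. -/
def act (i : Fin 34) (l : List (ℕ × Fin 34)) : List (ℕ × Fin 34) :=
  l.flatMap fun p => (table i p.2).map fun q => (p.1 + q.1, q.2)

/-- The list represents `0` over `𝔽₂[a]`: each term occurs an even number of times. -/
def IsNull (l : List (ℕ × Fin 34)) : Prop := ∀ x ∈ l, l.count x % 2 = 0

instance (l : List (ℕ × Fin 34)) : Decidable (IsNull l) :=
  inferInstanceAs (Decidable (∀ x ∈ l, l.count x % 2 = 0))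

theorem table_self : ∀ i, table i i = [] := by decide +kernel

theorem table_comm : ∀ i j, table i j = table j i := by decide +kernel

/-- The Jacobi identity for basis vectors, as an identity over `𝔽₂[a]`. In characteristic `2` the
Jacobian is symmetric, so ordered triples suffice. -/
theorem jacobi_table : ∀ i j, i ≤ j → ∀ k, j ≤ k →
    IsNull (act i (table j k) ++ act j (table k i) ++ act k (table i j)) := by
  decide +kernel

end WeisfeilerKac

/-! ### The 34-dimensional algebra -/

namespace WeisfeilerKac

open Module

section Value

variable {K : Type*} [Field K] {V : Type*} [AddCommGroup V] [Module K V]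

/-- The element that a list represents, for a given value of `a` and given basis vectors. -/
def value (a : K) (b : Fin 34 → V) (l : List (ℕ × Fin 34)) : V :=
  (l.map fun p => a ^ p.1 • b p.2).sum

variable (a : K) (b : Fin 34 → V)

@[simp] theorem value_nil : value a b [] = 0 := rfl

@[simp] theorem value_cons (p : ℕ × Fin 34) (l : List (ℕ × Fin 34)) :
    value a b (p :: l) = a ^ p.1 • b p.2 + value a b l := by
  simp [value]

theorem value_append (l m : List (ℕ × Fin 34)) :
    value a b (l ++ m) = value a b l + value a b m := by
  simp [value]

theorem map_value {W : Type*} [AddCommGroup W] [Module K W] (f : V →ₗ[K] W)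
    (l : List (ℕ × Fin 34)) : f (value a b l) = value a (fun i => f (b i)) l := by
  induction l with
  | nil => simp
  | cons p l ih => simp [ih]

theorem value_act (l : List (ℕ × Fin 34)) (i : Fin 34) :
    value a b (act i l) = value a (fun j => value a b (table i j)) l := by
  induction l with
  | nil => rfl
  | cons p l ih =>
    have h : act i (p :: l) = ((table i p.2).map fun q => (p.1 + q.1, q.2)) ++ act i l := by
      simp [act]
    rw [h, value_append, ih, value_cons]
    congr 1
    induction table i p.2 with
    | nil => simp
    | cons q m ihm => simp [ihm, pow_add, mul_smul]

theorem value_eq_zero_of_isNull [CharP K 2] {l : List (ℕ × Fin 34)} (hl : IsNull l) :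
    value a b l = 0 := by
  rw [value, Finset.sum_list_map_count]
  refine Finset.sum_eq_zero fun x hx => ?_
  obtain ⟨k, hk⟩ := Nat.dvd_of_mod_eq_zero (hl x (List.mem_toFinset.1 hx))
  have h : l.count x • a ^ x.1 • b x.2 = 0 := by
    rw [hk, ← Nat.cast_smul_eq_nsmul K]
    simp [CharTwo.two_eq_zero]
  convert h

end Value

/-- A bilinear map is alternating if it is so on a basis. -/
theorem apply_self_eq_zero {K V W ι : Type*} [Field K] [AddCommGroup V] [Module K V]
    [AddCommGroup W] [Module K W] [Fintype ι] (b : Basis ι K V) (C : V →ₗ[K] V →ₗ[K] W)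
    (hself : ∀ i, C (b i) (b i) = 0) (hswap : ∀ i j, C (b i) (b j) + C (b j) (b i) = 0)
    (x : V) : C x x = 0 := by
  classical
  have hflip : C + C.flip = 0 := b.ext fun i => b.ext fun j => by simpa using hswap i j
  have hxy : ∀ x y, C x y + C y x = 0 := fun x y =>
    LinearMap.congr_fun (LinearMap.congr_fun hflip x) y
  rw [← b.sum_repr x]
  generalize (Finset.univ : Finset ι) = s
  induction s using Finset.induction_on with
  | empty => simp
  | insert i s hi ih =>
    have h1 := hxy (b.repr x i • b i) (∑ j ∈ s, b.repr x j • b j)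
    have h2 : C (b.repr x i • b i) (b.repr x i • b i) = 0 := by simp [hself]
    rw [Finset.sum_insert hi]
    generalize b.repr x i • b i = y at *
    generalize ∑ j ∈ s, b.repr x j • b j = z at *
    rw [map_add, map_add, LinearMap.add_apply, LinearMap.add_apply, h2, ih, zero_add, add_zero,
      add_comm, h1]

/-- The `34`-dimensional space that carries the bracket of `table`. It is a type of its own because
`Fin 34 → K` already has a pointwise Lie bracket. -/
def Model {K : Type*} [Field K] (_a : K) : Type _ := Fin 34 → K

namespace Model

variable {K : Type*} [Field K] (a : K)

instance : AddCommGroup (Model a) := inferInstanceAs (AddCommGroup (Fin 34 → K))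

instance : Module K (Model a) := inferInstanceAs (Module K (Fin 34 → K))

/-- The standard basis. -/
noncomputable def basis : Basis (Fin 34) K (Model a) := Pi.basisFun K (Fin 34)

/-- The bracket, as a bilinear map. -/
noncomputable def lie : Model a →ₗ[K] Model a →ₗ[K] Model a :=
  (basis a).constr K fun i => (basis a).constr K fun j => value a (basis a) (table i j)

theorem lie_basis (i j : Fin 34) :
    lie a (basis a i) (basis a j) = value a (basis a) (table i j) := by
  simp [lie]

theorem neg_eq [CharP K 2] (x : Model a) : -x = x := by
  rw [← neg_one_smul K, CharTwo.neg_eq, one_smul]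

theorem lie_comm (x y : Model a) : lie a x y = lie a y x := by
  have h : lie a = (lie a).flip := by
    refine (basis a).ext fun i => (basis a).ext fun j => ?_
    rw [LinearMap.flip_apply, lie_basis, lie_basis, table_comm]
  conv_lhs => rw [h]
  rfl

/-- The Jacobian `[x, [y, z]] + [y, [x, z]] + [[x, y], z]`, as a trilinear map. -/
noncomputable def jacobian : Model a →ₗ[K] Model a →ₗ[K] Model a →ₗ[K] Model a :=
  LinearMap.mk₂ K (fun x y => lie a x ∘ₗ lie a y + lie a y ∘ₗ lie a x + lie a (lie a x y))
    (by intros; ext; simp; abel) (by intros; ext; simp)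
    (by intros; ext; simp; abel) (by intros; ext; simp)

theorem jacobian_apply (x y z : Model a) :
    jacobian a x y z = lie a x (lie a y z) + lie a y (lie a x z) + lie a (lie a x y) z := rfl

theorem jacobian_swap_left (x y z : Model a) : jacobian a x y z = jacobian a y x z := by
  rw [jacobian_apply, jacobian_apply, lie_comm a y x]
  abel

theorem jacobian_swap_right (x y z : Model a) : jacobian a x y z = jacobian a x z y := by
  rw [jacobian_apply, jacobian_apply, lie_comm a z y, lie_comm a z (lie a x y),
    lie_comm a y (lie a x z)]
  abel

variable [CharP K 2]

theorem lie_self (x : Model a) : lie a x x = 0 :=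
  apply_self_eq_zero (basis a) (lie a) (fun i => by rw [lie_basis, table_self, value_nil])
    (fun i j => by rw [lie_comm a (basis a j), add_eq_zero_iff_eq_neg, neg_eq]) x

theorem jacobian_basis (i j k : Fin 34) :
    jacobian a (basis a i) (basis a j) (basis a k) = 0 := by
  have key : ∀ i j k : Fin 34, i ≤ j → j ≤ k →
      jacobian a (basis a i) (basis a j) (basis a k) = 0 := by
    intro i j k hij hjk
    have h := value_eq_zero_of_isNull a (basis a) (jacobi_table i j hij k hjk)
    simp only [value_append, value_act, ← lie_basis] at h
    rw [jacobian_apply, lie_comm a (lie a _ _), lie_comm a (basis a i) (basis a k)]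
    simpa only [map_value, lie_basis] using h
  rcases le_total i j with h1 | h1 <;> rcases le_total j k with h2 | h2 <;>
    rcases le_total i k with h3 | h3
  · exact key _ _ _ h1 h2
  · exact key _ _ _ h1 h2
  · rw [jacobian_swap_right]; exact key _ _ _ h3 h2
  · rw [jacobian_swap_right, jacobian_swap_left]; exact key _ _ _ h3 h1
  · rw [jacobian_swap_left]; exact key _ _ _ h1 h3
  · rw [jacobian_swap_left, jacobian_swap_right]; exact key _ _ _ h2 h3
  · rw [jacobian_swap_left, jacobian_swap_right, jacobian_swap_left]; exact key _ _ _ h2 h1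
  · rw [jacobian_swap_left, jacobian_swap_right, jacobian_swap_left]; exact key _ _ _ h2 h1

theorem jacobian_eq_zero (x y z : Model a) : jacobian a x y z = 0 := by
  have h : jacobian a = 0 := (basis a).ext fun i => (basis a).ext fun j => (basis a).ext fun k => by
    simpa using jacobian_basis a i j k
  simp [h]

noncomputable instance : LieRing (Model a) where
  bracket x y := lie a x y
  add_lie x y z := by change lie a _ _ = lie a _ _ + lie a _ _; simp
  lie_add x y z := by change lie a _ _ = lie a _ _ + lie a _ _; simp
  lie_self x := lie_self a x
  leibniz_lie x y z := by
    have h := jacobian_eq_zero a x y z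
    rw [jacobian_apply, add_assoc, add_eq_zero_iff_eq_neg, neg_eq] at h
    change lie a x (lie a y z) = lie a (lie a x y) z + lie a y (lie a x z)
    rw [h, add_comm]

noncomputable instance : LieAlgebra K (Model a) where
  lie_smul c x y := by change lie a _ _ = c • lie a _ _; simp

end Model

/-- The brackets of the basis `b` of the Lie algebra `g` are those of `table`. The structure theory
is developed from such a basis, so that it applies both to `Model a` and to `G(F_{4,a})`. -/
def IsTableBasis {K g : Type*} [Field K] [LieRing g] [LieAlgebra K g] (a : K)
    (b : Basis (Fin 34) K g) : Prop :=
  ∀ i j, ⁅b i, b j⁆ = value a b (table i j)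

theorem Model.isTableBasis {K : Type*} [Field K] [CharP K 2] (a : K) :
    IsTableBasis a (Model.basis a) :=
  Model.lie_basis a

end WeisfeilerKac

/-! ### Simplicity and the 2-map -/

namespace WeisfeilerKac

open Module

/-- The indices of the toral basis vectors. -/
def torusIndex (k : Fin 4) : Fin 34 := Fin.castLE (by decide) k

/-- The weight of `b i` as an element of `𝔽₂⁴`: its values on the four toral basis vectors. -/
def weightVec (i : Fin 34) (k : Fin 4) : ZMod 2 := if (weight i).testBit k then 1 else 0

/-- The indices of the simple root vectors `e₁, e₂, e₃, e₄`. -/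
def eIndex : Fin 4 → Fin 34 := ![6, 12, 18, 10]

/-- The indices of the simple root vectors `f₁, f₂, f₃, f₄`. -/
def fIndex : Fin 4 → Fin 34 := ![7, 13, 19, 11]

/-- The index of `f_v` for that of `e_v`, and conversely; without meaning on toral indices. -/
def opposite (i : Fin 34) : Fin 34 := Fin.ofNat 34 (if (i : ℕ) % 2 = 0 then i + 1 else i - 1)

/-- The height of the positive root with the weight of `b i`. -/
def height (i : Fin 34) : ℕ := ((Nat.digits 10 (rootCode (weight i))).sum)

theorem weightVec_torusIndex : ∀ k, weightVec (torusIndex k) = 0 := by decide +kernel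

theorem exists_torusIndex_of_weightVec_eq_zero :
    ∀ i, weightVec i = 0 → ∃ k, torusIndex k = i := by decide +kernel

theorem torusIndex_injective : Function.Injective torusIndex := by decide +kernel

theorem eq_or_eq_opposite : ∀ i j, weightVec i ≠ 0 → weightVec j = weightVec i →
    j = i ∨ j = opposite i := by decide +kernel

theorem card_weightVec_fiber : ∀ ε : Fin 4 → ZMod 2, ε ≠ 0 →
    (Finset.univ.filter fun i => weightVec i = ε).card = 2 := by decide +kernel

theorem table_torusIndex : ∀ k i, table (torusIndex k) i =
    if (weight i).testBit k then [(0, i)] else [] := by decide +kernel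

/-- The coroot `[e_v, f_v]` has a coefficient of the form `a ^ p` or `a ^ p * (1 + a)`. -/
theorem table_opposite : ∀ i, weightVec i ≠ 0 →
    (∀ p ∈ table i (opposite i), ∃ k, torusIndex k = p.2) ∧
    ∃ m, ((table i (opposite i)).filter fun q => q.2 = m) ∈
      [[(0, m)], [(1, m)], [(1, m), (2, m)], [(2, m), (3, m)]] := by
  decide +kernel

/-- Every root vector which is not simple is the bracket of a simple one with one of smaller height.
-/
theorem table_chain : ∀ i,
    weightVec i = 0 ∨ (∃ k, i = eIndex k ∨ i = fIndex k) ∨ ∃ k j, height j < height i ∧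
      (table (eIndex k) j = [(0, i)] ∨ table (fIndex k) j = [(0, i)]) := by
  decide +kernel

theorem table_eIndex_fIndex : ∀ k, table (eIndex k) (fIndex k) =
    (![[(0, 0)], [(1, 1), (0, 3)], [(0, 2)], [(0, 3)]] : Fin 4 → List (ℕ × Fin 34)) k := by
  decide +kernel

theorem weightVec_eIndex : ∀ k, weightVec (eIndex k) =
    (![![0, 1, 0, 0], ![1, 0, 1, 0], ![0, 0, 0, 1], ![0, 0, 1, 0]] : Fin 4 → Fin 4 → ZMod 2) k := by
  decide +kernel

theorem weightVec_fIndex : ∀ k, weightVec (fIndex k) = weightVec (eIndex k) := by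
  decide +kernel

theorem ne_opposite : ∀ i, i ≠ opposite i := by decide +kernel

theorem table_sq : ∀ i j, weightVec i ≠ 0 → IsNull (act i (table i j)) := by decide +kernel

section

variable {K g : Type*} [Field K] [LieRing g] [LieAlgebra K g] {a : K} {b : Basis (Fin 34) K g}

section Generation

/-- The elements `e_i`, `f_i` generate the algebra. -/
theorem eq_top_of_gens_mem (hb : IsTableBasis a b) (ha : a ≠ 0) (S : LieSubalgebra K g)
    (he : ∀ k, b (eIndex k) ∈ S) (hf : ∀ k, b (fIndex k) ∈ S) : S = ⊤ := by
  have hh : ∀ k, value a b (table (eIndex k) (fIndex k)) ∈ S := fun k =>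
    hb _ _ ▸ S.lie_mem (he k) (hf k)
  simp only [table_eIndex_fIndex] at hh
  have h0 : b 0 ∈ S := by simpa using hh 0
  have h2 : b 2 ∈ S := by simpa using hh 2
  have h3 : b 3 ∈ S := by simpa using hh 3
  -- `h₂ = a • b 1 + b 3`, where `a` is invertible
  have h1 : b 1 ∈ S := by
    have h : a • b 1 + b 3 ∈ S := by simpa using hh 1
    have h' := S.smul_mem a⁻¹ (S.sub_mem h h3)
    rwa [add_sub_cancel_right, inv_smul_smul₀ ha] at h'
  have hT : ∀ k, b (torusIndex k) ∈ S := by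
    intro k
    fin_cases k
    exacts [h0, h1, h2, h3]
  have hroot : ∀ n i, height i < n → b i ∈ S := by
    intro n
    induction n with
    | zero => intro i hi; omega
    | succ n ih =>
      intro i hi
      rcases table_chain i with h | ⟨k, h | h⟩ | ⟨k, j, hj, h⟩
      · obtain ⟨k, rfl⟩ := exists_torusIndex_of_weightVec_eq_zero i h
        exact hT k
      · exact h ▸ he k
      · exact h ▸ hf k
      · have hj' := ih j (by omega)
        rcases h with h | h
        · have h' := S.lie_mem (he k) hj'
          rw [hb, h] at h'
          simpa using h'
        · have h' := S.lie_mem (hf k) hj'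
          rw [hb, h] at h'
          simpa using h'
  rw [eq_top_iff]
  intro x _
  rw [← b.sum_repr x]
  exact S.sum_mem fun i _ => S.smul_mem _ (hroot _ i (Nat.lt_succ_self _))

end Generation

theorem eq_sum_torus {x : g} (hx : ∀ i, weightVec i ≠ 0 → b.repr x i = 0) :
    x = ∑ k, b.repr x (torusIndex k) • b (torusIndex k) := by
  conv_lhs => rw [← b.sum_repr x]
  rw [← Finset.sum_image (s := Finset.univ) (g := torusIndex)
    (f := fun i => b.repr x i • b i) (fun _ _ _ _ h => torusIndex_injective h)]
  symm
  refine Finset.sum_subset (Finset.subset_univ _) fun i _ hi => ?_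
  rw [hx i, zero_smul]
  intro h
  obtain ⟨k, rfl⟩ := exists_torusIndex_of_weightVec_eq_zero i h
  exact hi (Finset.mem_image_of_mem _ (Finset.mem_univ k))

variable [CharP K 2]

variable (K) in
/-- The inclusion of the prime field. -/
abbrev castF2 : ZMod 2 →+* K := ZMod.castHom (dvd_refl 2) K

theorem lie_torus (hb : IsTableBasis a b) (k : Fin 4) (i : Fin 34) :
    ⁅b (torusIndex k), b i⁆ = castF2 K (weightVec i k) • b i := by
  rw [hb, table_torusIndex, weightVec]
  split_ifs <;> simp

theorem repr_lie_torus (hb : IsTableBasis a b) (k : Fin 4) (x : g) (i : Fin 34) :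
    b.repr ⁅b (torusIndex k), x⁆ i = castF2 K (weightVec i k) * b.repr x i := by
  have h : b.coord i ∘ₗ (LieAlgebra.ad K g (b (torusIndex k)) : g →ₗ[K] g) =
      castF2 K (weightVec i k) • b.coord i := by
    refine b.ext fun j => ?_
    simp only [LinearMap.comp_apply, LieAlgebra.ad_apply, lie_torus hb, map_smul,
      LinearMap.smul_apply, Basis.coord_apply, Basis.repr_self]
    by_cases hij : j = i
    · rw [hij]
    · simp [Finsupp.single_eq_of_ne' hij]
  exact LinearMap.congr_fun h x

theorem repr_lie_sum_torus (hb : IsTableBasis a b) (c : Fin 4 → K) (x : g) (i : Fin 34) :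
    b.repr ⁅∑ k, c k • b (torusIndex k), x⁆ i =
      (∑ k, c k * castF2 K (weightVec i k)) * b.repr x i := by
  simp only [sum_lie, smul_lie, map_sum, map_smul, Finsupp.coe_finsetSum, Finset.sum_apply,
    Finsupp.smul_apply, repr_lie_torus hb, smul_eq_mul, Finset.sum_mul, mul_assoc]

/-- A nonzero toral element in an ideal `I` pulls a pair `e_j, f_j` into `I`, because the simple
roots span the dual of the torus; then `h_j = [e_j, f_j]` pulls in the neighbours of `j`, and the
Dynkin diagram is connected. -/
theorem eq_top_of_torus_mem (hb : IsTableBasis a b) (ha : a ≠ 0) (I : LieIdeal K g)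
    (c : Fin 4 → K) (hc : c ≠ 0) (hI : ∑ k, c k • b (torusIndex k) ∈ I) : I = ⊤ := by
  have pull : ∀ c' : Fin 4 → K, ∑ k, c' k • b (torusIndex k) ∈ I → ∀ i,
      ∑ k, c' k * castF2 K (weightVec i k) ≠ 0 → b i ∈ I := by
    intro c' hc' i hi
    have h := lie_mem_left K g I _ (b i) hc'
    have h' : ⁅∑ k, c' k • b (torusIndex k), b i⁆ =
        (∑ k, c' k * castF2 K (weightVec i k)) • b i := by
      simp only [sum_lie, smul_lie, lie_torus hb, smul_smul, Finset.sum_smul]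
    rw [h'] at h
    exact (I.toSubmodule.smul_mem_iff hi).1 h
  have step : ∀ (c' : Fin 4 → K) (j k : Fin 4), ∑ k, c' k • b (torusIndex k) =
      value a b (table (eIndex j) (fIndex j)) →
      b (eIndex j) ∈ I → ∑ l, c' l * castF2 K (weightVec (eIndex k) l) ≠ 0 →
      b (eIndex k) ∈ I ∧ b (fIndex k) ∈ I := by
    intro c' j k hc' hj hk
    have h := lie_mem_left K g I _ (b (fIndex j)) hj
    rw [hb, ← hc'] at h
    exact ⟨pull c' h _ hk, pull c' h _ (by rwa [weightVec_fIndex])⟩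
  have h01 : b (eIndex 0) ∈ I → b (eIndex 1) ∈ I ∧ b (fIndex 1) ∈ I := fun h =>
    step ![1, 0, 0, 0] 0 1 (by simp [Fin.sum_univ_four, table_eIndex_fIndex, torusIndex]) h
      (by simp [Fin.sum_univ_four, weightVec_eIndex])
  have h10 : b (eIndex 1) ∈ I → b (eIndex 0) ∈ I ∧ b (fIndex 0) ∈ I := fun h =>
    step ![0, a, 0, 1] 1 0 (by simp [Fin.sum_univ_four, table_eIndex_fIndex, torusIndex]) h
      (by simp [Fin.sum_univ_four, weightVec_eIndex, ha])
  have h12 : b (eIndex 1) ∈ I → b (eIndex 2) ∈ I ∧ b (fIndex 2) ∈ I := fun h =>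
    step ![0, a, 0, 1] 1 2 (by simp [Fin.sum_univ_four, table_eIndex_fIndex, torusIndex]) h
      (by simp [Fin.sum_univ_four, weightVec_eIndex])
  have h21 : b (eIndex 2) ∈ I → b (eIndex 1) ∈ I ∧ b (fIndex 1) ∈ I := fun h =>
    step ![0, 0, 1, 0] 2 1 (by simp [Fin.sum_univ_four, table_eIndex_fIndex, torusIndex]) h
      (by simp [Fin.sum_univ_four, weightVec_eIndex])
  have h23 : b (eIndex 2) ∈ I → b (eIndex 3) ∈ I ∧ b (fIndex 3) ∈ I := fun h =>
    step ![0, 0, 1, 0] 2 3 (by simp [Fin.sum_univ_four, table_eIndex_fIndex, torusIndex]) h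
      (by simp [Fin.sum_univ_four, weightVec_eIndex])
  have h32 : b (eIndex 3) ∈ I → b (eIndex 2) ∈ I ∧ b (fIndex 2) ∈ I := fun h =>
    step ![0, 0, 0, 1] 3 2 (by simp [Fin.sum_univ_four, table_eIndex_fIndex, torusIndex]) h
      (by simp [Fin.sum_univ_four, weightVec_eIndex])
  have start : b (eIndex 1) ∈ I := by
    by_cases h1 : c 1 = 0
    · by_cases h2 : c 2 = 0
      · by_cases h3 : c 3 = 0
        · have h0 : c 0 ≠ 0 := by
            intro h0
            refine hc (funext fun k => ?_)
            fin_cases k <;> assumption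
          exact pull c hI _ (by simpa [Fin.sum_univ_four, weightVec_eIndex, h2] using h0)
        · exact (h21 (pull c hI _ (by simpa [Fin.sum_univ_four, weightVec_eIndex] using h3))).1
      · exact (h21 (h32 (pull c hI _
          (by simpa [Fin.sum_univ_four, weightVec_eIndex] using h2))).1).1
    · exact (h01 (pull c hI _ (by simpa [Fin.sum_univ_four, weightVec_eIndex] using h1))).1
  have all : ∀ k, b (eIndex k) ∈ I ∧ b (fIndex k) ∈ I := by
    intro k
    fin_cases k
    · exact h10 start
    · exact h21 (h12 start).1
    · exact h12 start
    · exact h23 (h12 start).1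
  have htop := eq_top_of_gens_mem hb ha (LieIdeal.toLieSubalgebra K g I) (fun k => (all k).1)
    (fun k => (all k).2)
  rw [eq_top_iff]
  intro x _
  have hx : x ∈ LieIdeal.toLieSubalgebra K g I := htop ▸ LieSubalgebra.mem_top x
  exact hx

/-- The coroots do not vanish; this is where `a ≠ 1` is needed. -/
theorem exists_lie_opposite_eq (hb : IsTableBasis a b) (ha : a ≠ 0) (ha1 : a ≠ 1) (i : Fin 34)
    (hi : weightVec i ≠ 0) : ∃ c : Fin 4 → K, c ≠ 0 ∧
      ⁅b i, b (opposite i)⁆ = ∑ k, c k • b (torusIndex k) := by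
  obtain ⟨hT, m, hm⟩ := table_opposite i hi
  have hrepr : ∀ (l : List (ℕ × Fin 34)) (m : Fin 34), b.repr (value a b l) m =
      ((l.filter fun q => q.2 = m).map fun q => a ^ q.1).sum := by
    intro l m
    induction l with
    | nil => simp
    | cons p l ih =>
      rw [value_cons, map_add, Finsupp.add_apply, ih, map_smul, Basis.repr_self,
        Finsupp.smul_apply, Finsupp.single_apply, List.filter_cons]
      by_cases h : p.2 = m <;> simp [h]
  have h1 : (1 : K) + a ≠ 0 := fun h => ha1 (by
    rw [← CharTwo.neg_eq a]; exact (neg_eq_of_add_eq_zero_left h).symm ▸ rfl)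
  have hne : b.repr (value a b (table i (opposite i))) m ≠ 0 := by
    rw [hrepr]
    simp only [List.mem_cons, List.not_mem_nil, or_false] at hm
    rcases hm with h | h | h | h <;> rw [h]
    · simp
    · simpa using ha
    · have : a ^ 1 + a ^ 2 = a * (1 + a) := by ring
      simpa only [List.map_cons, List.map_nil, List.sum_cons, List.sum_nil, add_zero, this] using
        mul_ne_zero (by simpa using ha) h1
    · have : a ^ 2 + a ^ 3 = a ^ 2 * (1 + a) := by ring
      simpa only [List.map_cons, List.map_nil, List.sum_cons, List.sum_nil, add_zero, this] using
        mul_ne_zero (by simpa using ha) h1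
  have hsum := eq_sum_torus (b := b) (x := value a b (table i (opposite i))) fun j hj => by
    rw [hrepr, List.filter_eq_nil_iff.2]
    · rfl
    · intro p hp hpj
      obtain ⟨k, hk⟩ := hT p hp
      have : p.2 = j := by simpa using hpj
      exact hj (by rw [← this, ← hk, weightVec_torusIndex])
  refine ⟨_, ?_, (hb _ _).trans hsum⟩
  intro h0
  apply hne
  rw [hsum]
  simp only [funext_iff, Pi.zero_apply] at h0
  simp [h0]

/-- A nonzero ideal contains a weight vector `x`. If `x` has a nonzero weight, its bracket with one
of the two root vectors of that weight is a nonzero multiple of the coroot, so that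
`eq_top_of_torus_mem` applies. -/
theorem isSimple (hb : IsTableBasis a b) (ha : a ≠ 0) (ha1 : a ≠ 1) :
    LieAlgebra.IsSimple K g where
  non_abelian h := by
    have h1 := lie_torus hb 1 (eIndex 0)
    rw [h.trivial, weightVec_eIndex] at h1
    exact b.ne_zero (eIndex 0) (by simpa using h1.symm)
  eq_bot_or_eq_top I := by
    refine or_iff_not_imp_left.2 fun hI => ?_
    obtain ⟨x, hxI, hx0⟩ := Submodule.exists_mem_ne_zero_of_ne_bot
      (fun h => hI ((LieSubmodule.toSubmodule_eq_bot I).1 h))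
    -- as `(ad t)² = ad t` for toral `t`, one of `y`, `[t, y]` is a nonzero eigenvector of `ad t`
    have cut : ∀ s : Finset (Fin 4), ∃ x ∈ I, x ≠ 0 ∧ ∀ k ∈ s, ∃ ε : ZMod 2,
        ⁅b (torusIndex k), x⁆ = castF2 K ε • x := by
      intro s
      induction s using Finset.induction_on with
      | empty => exact ⟨x, hxI, hx0, by simp⟩
      | insert k s _ ih =>
        obtain ⟨y, hyI, hy0, hy⟩ := ih
        by_cases hky : ⁅b (torusIndex k), y⁆ = 0
        · refine ⟨y, hyI, hy0, fun l hl => ?_⟩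
          rcases Finset.mem_insert.1 hl with rfl | hl
          · exact ⟨0, by simpa using hky⟩
          · exact hy l hl
        · refine ⟨_, lie_mem_right K g I _ _ hyI, hky, fun l hl => ?_⟩
          rcases Finset.mem_insert.1 hl with rfl | hl
          · refine ⟨1, b.repr.injective (Finsupp.ext fun i => ?_)⟩
            rw [map_one, one_smul, repr_lie_torus hb, repr_lie_torus hb, ← mul_assoc, ← map_mul]
            congr 2
            generalize weightVec i l = z
            revert z
            decide
          · obtain ⟨ε, hε⟩ := hy l hl
            refine ⟨ε, ?_⟩
            rw [← lie_smul, ← hε]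
            refine b.repr.injective (Finsupp.ext fun i => ?_)
            simp only [repr_lie_torus hb]
            ring
    obtain ⟨y, hyI, hy0, hy⟩ := cut Finset.univ
    choose! ε hε using hy
    have hwt : ∀ i, b.repr y i ≠ 0 → weightVec i = ε := by
      intro i hi
      funext k
      have h := repr_lie_torus hb k y i
      rw [hε k (Finset.mem_univ k), map_smul, Finsupp.smul_apply, smul_eq_mul] at h
      exact ((castF2 K).injective (mul_right_cancel₀ hi h)).symm
    have hy' : b.repr y ≠ 0 := fun h => hy0 (b.repr.map_eq_zero_iff.1 h)
    obtain ⟨i, hi⟩ := Finsupp.ne_iff.1 hy'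
    rw [Finsupp.zero_apply] at hi
    by_cases hi0 : weightVec i = 0
    · have hsum := eq_sum_torus (b := b) (x := y) fun j hj => by
        by_contra h
        exact hj ((hwt j h).trans ((hwt i hi).symm.trans hi0))
      refine eq_top_of_torus_mem hb ha I _ ?_ (hsum ▸ hyI)
      intro h0
      apply hy0
      rw [hsum]
      simp only [funext_iff, Pi.zero_apply] at h0
      simp [h0]
    · have hopp : y = b.repr y i • b i + b.repr y (opposite i) • b (opposite i) := by
        conv_lhs => rw [← b.sum_repr y]
        rw [← Finset.sum_pair (f := fun j => b.repr y j • b j) (ne_opposite i)]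
        symm
        refine Finset.sum_subset (Finset.subset_univ _) fun j _ hj => ?_
        by_cases h : b.repr y j = 0
        · rw [h, zero_smul]
        · refine absurd ?_ hj
          rcases eq_or_eq_opposite i j hi0 ((hwt j h).trans (hwt i hi).symm) with h | h <;>
            simp [h]
      obtain ⟨c, hc, hlie⟩ := exists_lie_opposite_eq hb ha ha1 i hi0
      have h := lie_mem_left K g I _ (b (opposite i)) hyI
      rw [hopp, add_lie, smul_lie, smul_lie, lie_self, smul_zero, add_zero, hlie] at h
      exact eq_top_of_torus_mem hb ha I c hc ((I.toSubmodule.smul_mem_iff hi).1 h)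

section TwoMap

variable (b) in
/-- A bilinear map `B` with `B x y + B y x = [x, y]`, upper triangular in the basis `b`. Its
diagonal is the `2`-map that fixes the toral basis vectors and kills the root vectors. -/
noncomputable def twoMapAux : g →ₗ[K] g →ₗ[K] g :=
  b.constr K fun i => b.constr K fun j =>
    if i < j then ⁅b i, b j⁆ else if i = j ∧ weightVec i = 0 then b i else 0

theorem twoMapAux_add_flip (x y : g) :
    twoMapAux b x y + twoMapAux b y x = ⁅x, y⁆ := by
  have h2 : ∀ z : g, z + z = 0 := fun z => by
    rw [← two_smul K, CharTwo.two_eq_zero, zero_smul]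
  have h : twoMapAux b + (twoMapAux b).flip = (LieAlgebra.ad K g : g →ₗ[K] Module.End K g) := by
    refine b.ext fun i => b.ext fun j => ?_
    simp only [twoMapAux, LinearMap.add_apply, LinearMap.flip_apply, Basis.constr_basis]
    change _ = ⁅b i, b j⁆
    rcases lt_trichotomy i j with hij | rfl | hij
    · simp [hij, hij.not_gt, hij.ne']
    · simp [h2]
    · rw [if_neg hij.not_gt, if_neg (fun h => hij.ne' h.1), if_pos hij, zero_add, ← lie_skew,
        neg_eq_of_add_eq_zero_left (h2 _)]
  exact LinearMap.congr_fun (LinearMap.congr_fun h x) y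

/-- Both `ad (B x x)` and `(ad x)²` are quadratic in `x` with the same polar form, so it is enough
to compare them on the basis: `(ad t)² = ad t` for toral `t`, and `(ad x)² = 0` for root vectors
`x`. -/
theorem exists_isTwoMap (hb : IsTableBasis a b) : ∃ P : g → g, IsTwoMap K P := by
  have h2 : ∀ z : Module.End K g, z + z = 0 := fun z => by
    rw [← two_smul K, CharTwo.two_eq_zero, zero_smul]
  let A : g →ₗ[K] Module.End K g := (LieAlgebra.ad K g : g →ₗ[K] Module.End K g)
  have hA : ∀ x y, A x * A y + A y * A x = A ⁅x, y⁆ := by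
    intro x y
    ext z
    change ⁅x, ⁅y, z⁆⁆ + ⁅y, ⁅x, z⁆⁆ = ⁅⁅x, y⁆, z⁆
    have h := LinearMap.congr_fun (h2 (A y * A x)) z
    change ⁅y, ⁅x, z⁆⁆ + ⁅y, ⁅x, z⁆⁆ = 0 at h
    rw [lie_lie, sub_eq_add_neg, neg_eq_of_add_eq_zero_left h]
  refine ⟨fun x => twoMapAux b x x, ⟨fun x y => ?_, fun c x => ?_, fun x => ?_⟩⟩
  · rw [← twoMapAux_add_flip (b := b) x y]
    simp only [map_add, LinearMap.add_apply]
    abel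
  · simp only [map_smul, LinearMap.smul_apply, smul_smul, sq]
  · let C : g →ₗ[K] g →ₗ[K] Module.End K g :=
      LinearMap.mk₂ K (fun x y => A (twoMapAux b x y) + A x * A y)
        (by intros; simp [add_mul]; abel) (by intros; simp)
        (by intros; simp [mul_add]; abel) (by intros; simp)
    have hC : C x x = 0 := by
      refine apply_self_eq_zero b C (fun i => ?_) (fun i j => ?_) x
      · change A (twoMapAux b (b i) (b i)) + A (b i) * A (b i) = 0
        simp only [twoMapAux, Basis.constr_basis, lt_irrefl, if_false, true_and]
        refine b.ext fun j => ?_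
        split_ifs with hi
        · obtain ⟨k, rfl⟩ := exists_torusIndex_of_weightVec_eq_zero i hi
          change ⁅b (torusIndex k), b j⁆ + ⁅b (torusIndex k), ⁅b (torusIndex k), b j⁆⁆ = 0
          rw [lie_torus hb, lie_smul, lie_torus hb, smul_smul, ← add_smul, ← map_mul, ← map_add]
          generalize weightVec j k = z
          have : z + z * z = 0 := by revert z; decide
          rw [this, map_zero, zero_smul]
        · rw [map_zero, zero_add]
          change ⁅b i, ⁅b i, b j⁆⁆ = 0
          have h := value_eq_zero_of_isNull a b (table_sq i j hi)
          rw [value_act] at h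
          rw [hb, ← LieAlgebra.ad_apply K g, map_value]
          have hb' : ∀ j, ⁅b i, b j⁆ = value a b (table i j) := hb i
          simpa only [LieAlgebra.ad_apply, hb'] using h
      · change (A (twoMapAux b (b i) (b j)) + A (b i) * A (b j)) +
          (A (twoMapAux b (b j) (b i)) + A (b j) * A (b i)) = 0
        rw [add_add_add_comm, ← map_add, twoMapAux_add_flip, hA, h2]
    change A (twoMapAux b x x) + A x * A x = 0 at hC
    change A (twoMapAux b x x) = A x ^ 2
    rw [sq, ← neg_eq_of_add_eq_zero_left hC, neg_eq_of_add_eq_zero_left (h2 _)]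

end TwoMap

end
end WeisfeilerKac

/-! ### Fixed vectors of Frobenius-semilinear maps -/

namespace WeisfeilerKac

open Module Polynomial

section Lang

variable {K : Type*} [Field K]

theorem exists_sq_eq [IsAlgClosed K] (c : K) : ∃ d : K, d ^ 2 = c :=
  IsAlgClosed.exists_pow_nat_eq c two_pos

/-- The polynomials `D_n` such that `z ^ 2 * D_n(z)` is the `n`-th coefficient of a fixed vector `∑
β_i φ^i v` with last coefficient `z`, when `c` are the coefficients of the relation satisfied by
`v`. -/
noncomputable def fixedCoeff (c : ℕ → K) : ℕ → K[X]
  | 0 => C (c 0)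
  | n + 1 => X ^ 2 * fixedCoeff c n ^ 2 + C (c (n + 1))

theorem coeff_eq_zero_of_fixedCoeff_eq_zero (c : ℕ → K) : ∀ n, fixedCoeff c n = 0 →
    ∀ i ≤ n, c i = 0
  | 0, h, i, hi => by
    obtain rfl : i = 0 := by omega
    exact C_eq_zero.1 h
  | n + 1, h, i, hi => by
    have h0 : c (n + 1) = 0 := by
      simpa [fixedCoeff] using congrArg (eval 0) h
    rcases Nat.lt_or_eq_of_le hi with hi | rfl
    · refine coeff_eq_zero_of_fixedCoeff_eq_zero c n ?_ i (by omega)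
      simpa [fixedCoeff, h0] using h
    · exact h0

variable [CharP K 2] {V : Type*} [AddCommGroup V] [Module K V]
  [FiniteDimensional K V] [IsAlgClosed K]

/-- For a vector `v` with a shortest relation `φ^(m+1) v = ∑ c_i φ^i v`, the vector `∑ β_i φ^i v`
with `β_m = z` is fixed if and only if `β_0 = z² c_0`, `β_(i+1) = β_i² + z² c_(i+1)` and `β_m = z`,
which is a polynomial equation for `z` with a nonzero solution. -/
theorem exists_fixed_ne_zero [Nontrivial V] (φ : V →ₛₗ[frobenius K 2] V)
    (hφ : Function.Injective φ) : ∃ w ≠ 0, φ w = w := by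
  classical
  obtain ⟨v, hv⟩ := exists_ne (0 : V)
  -- a relation of minimal length between the iterates of `v`
  have hex : ∃ r, ∃ c : ℕ → K, φ^[r] v = ∑ i ∈ Finset.range r, c i • φ^[i] v := by
    let U : ℕ →o Submodule K V := ⟨fun r => Submodule.span K ((fun i => φ^[i] v) '' Finset.range r),
      fun r s hrs => Submodule.span_mono (Set.image_mono (by
        intro i hi; simp only [Finset.coe_range, Set.mem_Iio] at hi ⊢; omega))⟩
    obtain ⟨r, hr⟩ := WellFoundedGT.monotone_chain_condition U
    have h : φ^[r] v ∈ U r := by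
      rw [hr (r + 1) (Nat.le_succ r)]
      exact Submodule.subset_span ⟨r, by simp, rfl⟩
    obtain ⟨c, hc⟩ := (Submodule.mem_span_image_finset_iff_exists_fun' K).1 h
    exact ⟨r, c, hc.symm⟩
  obtain ⟨c, hc⟩ := Nat.find_spec hex
  have hmin := fun m => Nat.find_min (m := m) hex
  generalize Nat.find hex = r at hc hmin
  obtain _ | m := r
  · exact absurd (by simpa using hc) hv
  have hD : fixedCoeff c m ≠ 0 := by
    intro h
    have h0 := coeff_eq_zero_of_fixedCoeff_eq_zero c m h
    rw [Finset.sum_eq_zero fun i hi => by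
      rw [h0 i (Nat.lt_succ_iff.1 (Finset.mem_range.1 hi)), zero_smul]] at hc
    have : φ^[m + 1] 0 = 0 := Function.iterate_fixed (map_zero φ) _
    exact hv (hφ.iterate (m + 1) (hc.trans this.symm))
  obtain ⟨z, hz⟩ : ∃ z, (X * fixedCoeff c m - C 1).IsRoot z := by
    refine IsAlgClosed.exists_root _ ?_
    rw [degree_sub_C] <;> rw [degree_mul, degree_X, degree_eq_natDegree hD] <;> norm_cast
    · omega
    · omega
  have hz1 : z * (fixedCoeff c m).eval z = 1 := by
    simpa [sub_eq_zero] using hz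
  have hz0 : z ≠ 0 := left_ne_zero_of_mul_eq_one hz1
  set β : ℕ → K := fun i => z ^ 2 * (fixedCoeff c i).eval z with hβ
  have hβm : β m = z := by
    rw [hβ]; linear_combination z * hz1
  refine ⟨∑ i ∈ Finset.range (m + 1), β i • φ^[i] v, ?_, ?_⟩
  · intro h
    refine hmin m (Nat.lt_succ_self m) ⟨fun i => -(z⁻¹ * β i), ?_⟩
    rw [Finset.sum_range_succ, hβm, add_eq_zero_iff_eq_neg', eq_comm] at h
    rw [← inv_smul_smul₀ hz0 (φ^[m] v), ← h, smul_neg, Finset.smul_sum,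
      ← Finset.sum_neg_distrib]
    simp [mul_smul]
  · have h1 : φ (∑ i ∈ Finset.range (m + 1), β i • φ^[i] v) =
        ∑ i ∈ Finset.range (m + 1), β i ^ 2 • φ^[i + 1] v := by
      rw [map_sum]
      refine Finset.sum_congr rfl fun i _ => ?_
      rw [LinearMap.map_smulₛₗ, frobenius_def, Function.iterate_succ_apply']
    rw [h1, Finset.sum_range_succ, hβm, hc, Finset.smul_sum, Finset.sum_range_succ',
      Finset.sum_range_succ' (fun i => β i • φ^[i] v), ← add_assoc, ← Finset.sum_add_distrib]
    congr 1
    · refine Finset.sum_congr rfl fun i _ => ?_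
      rw [smul_smul, ← add_smul]
      congr 1
      simp only [hβ, fixedCoeff, eval_add, eval_mul, eval_pow, eval_X, eval_C]
      ring
    · simp [hβ, fixedCoeff, mul_smul]

/-- Lang's theorem for an injective Frobenius-semilinear map: its fixed vectors span the space. A
fixed vector of the quotient by their span lifts to a fixed vector by solving Artin–Schreier
equations. -/
theorem span_fixed_eq_top (φ : V →ₛₗ[frobenius K 2] V) (hφ : Function.Injective φ) :
    Submodule.span K {v | φ v = v} = ⊤ := by
  set F := Submodule.span K {v | φ v = v} with hF
  by_contra hne
  have hmap : F ≤ F.comap φ := Submodule.span_le.2 fun v hv => by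
    change φ v ∈ F
    rw [hv]
    exact Submodule.subset_span hv
  have hsurj : ∀ f ∈ F, ∃ g ∈ F, φ g = f := by
    intro f hf
    induction hf using Submodule.closure_induction with
    | zero => exact ⟨0, F.zero_mem, map_zero φ⟩
    | add x y _ _ hx hy =>
      obtain ⟨x', hx', rfl⟩ := hx
      obtain ⟨y', hy', rfl⟩ := hy
      exact ⟨x' + y', F.add_mem hx' hy', map_add φ _ _⟩
    | smul_mem c x hx =>
      obtain ⟨d, rfl⟩ := exists_sq_eq c
      refine ⟨d • x, F.smul_mem _ (Submodule.subset_span hx), ?_⟩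
      rw [LinearMap.map_smulₛₗ, frobenius_def, hx]
  have hAS : ∀ f ∈ F, ∃ g ∈ F, φ g - g = f := by
    intro f hf
    induction hf using Submodule.closure_induction with
    | zero => exact ⟨0, F.zero_mem, by simp⟩
    | add x y _ _ hx hy =>
      obtain ⟨x', hx', rfl⟩ := hx
      obtain ⟨y', hy', rfl⟩ := hy
      exact ⟨x' + y', F.add_mem hx' hy', by rw [map_add]; abel⟩
    | smul_mem c x hx =>
      obtain ⟨d, hd⟩ : ∃ d, (X ^ 2 - X - C c : K[X]).IsRoot d := by
        refine IsAlgClosed.exists_root _ ?_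
        have : (X ^ 2 - X - C c : K[X]).degree = 2 := by compute_degree!
        rw [this]; decide
      refine ⟨d • x, F.smul_mem _ (Submodule.subset_span hx), ?_⟩
      rw [LinearMap.map_smulₛₗ, frobenius_def, hx, ← sub_smul]
      congr 1
      simpa [sub_eq_zero] using hd
  have : Nontrivial (V ⧸ F) := Submodule.Quotient.nontrivial_iff.2 hne
  obtain ⟨w, hw0, hw⟩ := exists_fixed_ne_zero (F.mapQ F φ hmap) (by
    rw [injective_iff_map_eq_zero]
    intro x hx
    obtain ⟨x, rfl⟩ := Submodule.Quotient.mk_surjective _ x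
    rw [Submodule.mapQ_apply, Submodule.Quotient.mk_eq_zero] at hx
    obtain ⟨y, hy, hyx⟩ := hsurj _ hx
    rwa [Submodule.Quotient.mk_eq_zero, ← hφ hyx])
  obtain ⟨w, rfl⟩ := Submodule.Quotient.mk_surjective _ w
  rw [Submodule.mapQ_apply, Submodule.Quotient.eq] at hw
  obtain ⟨g, hg, hgw⟩ := hAS _ hw
  refine hw0 ((Submodule.Quotient.mk_eq_zero F).2 ?_)
  have h : w - g ∈ F := Submodule.subset_span (by
    change φ (w - g) = w - g
    rw [map_sub]
    exact sub_eq_sub_iff_sub_eq_sub.2 hgw.symm)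
  simpa using F.add_mem h hg

end Lang

end WeisfeilerKac

/-! ### Tori and centralizers -/

namespace WeisfeilerKac

open Module Polynomial

section Tori

variable {K g : Type*} [Field K] [CharP K 2] [LieRing g] [LieAlgebra K g] {P : g → g}

omit [CharP K 2] in
theorem _root_.IsTwoMap.map_zero (hP : IsTwoMap K P) : P 0 = 0 := by
  simpa using hP.map_smul 0 0

omit [CharP K 2] in
theorem _root_.IsTwoMap.ad_iterate (hP : IsTwoMap K P) (x : g) (k : ℕ) :
    LieAlgebra.ad K g (P^[k] x) = LieAlgebra.ad K g x ^ 2 ^ k := by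
  induction k with
  | zero => simp
  | succ k ih => rw [Function.iterate_succ_apply', hP.ad_map, ih, ← pow_mul, pow_succ 2]

omit [CharP K 2] in
theorem _root_.IsTwoMap.lie_iterate_eq_zero (hP : IsTwoMap K P) {x y : g} (h : ⁅x, y⁆ = 0) (k : ℕ) :
    ⁅P^[k] x, y⁆ = 0 := by
  rw [← LieAlgebra.ad_apply K g, hP.ad_iterate,
    ← Nat.succ_pred_eq_of_pos (show 0 < 2 ^ k by positivity), pow_succ]
  simp [h]

omit [CharP K 2] in
theorem _root_.IsTwoMap.lie_iterate_self (hP : IsTwoMap K P) (x : g) (k : ℕ) :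
    ⁅x, P^[k] x⁆ = 0 := by
  rw [← lie_skew, hP.lie_iterate_eq_zero (lie_self x), neg_zero]

variable [IsAlgClosed K] [FiniteDimensional K g]

/-- A commutative subspace on which the `2`-map is injective is spanned by toral elements. -/
theorem _root_.IsTwoMap.le_span_toral (hP : IsTwoMap K P) (W : Submodule K g)
    (hW : ∀ x ∈ W, P x ∈ W) (hcomm : ∀ x ∈ W, ∀ y ∈ W, ⁅x, y⁆ = 0)
    (hinj : ∀ x ∈ W, P x = 0 → x = 0) : W ≤ Submodule.span K {t | t ∈ W ∧ P t = t} := by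
  let φ : W →ₛₗ[frobenius K 2] W :=
    { toFun := fun x => ⟨P x, hW x x.2⟩
      map_add' := fun x y => Subtype.ext (by
        simp [hP.map_add, hcomm x x.2 y y.2])
      map_smul' := fun c x => Subtype.ext (by simp [hP.map_smul, frobenius_def]) }
  have h := span_fixed_eq_top φ (by
    rw [injective_iff_map_eq_zero]
    exact fun x hx => Subtype.ext (hinj x x.2 (congrArg Subtype.val hx)))
  intro x hx
  have hx' : W.subtype ⟨x, hx⟩ ∈ (⊤ : Submodule K W).map W.subtype :=
    Submodule.mem_map_of_mem Submodule.mem_top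
  rw [← h, Submodule.map_span] at hx'
  refine Submodule.span_mono ?_ hx'
  rintro _ ⟨t, ht, rfl⟩
  exact ⟨t.2, congrArg Subtype.val ht⟩

variable {T : LieSubalgebra K g}

omit [CharP K 2] [IsAlgClosed K] [FiniteDimensional K g] in
theorem _root_.IsTorus.eq_zero (hP : IsTwoMap K P) (hT : IsTorus P T) {x : g} (hx : x ∈ T)
    (h : P x = 0) : x = 0 :=
  hT.injOn hx T.zero_mem (h.trans hP.map_zero.symm)

/-- Elements `x` of a torus are semisimple: `x` lies in the span of the `x^[2]^k` with `k ≥ 1`,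
which act as powers of `ad x` with exponents at least `2`. -/
theorem _root_.IsTorus.lie_eq_zero (hP : IsTwoMap K P) (hT : IsTorus P T) {x : g} (hx : x ∈ T)
    {y : g} (hy : ⁅x, ⁅x, y⁆⁆ = 0) : ⁅x, y⁆ = 0 := by
  have hmem : ∀ k, P^[k] x ∈ T := fun k => by
    induction k with
    | zero => exact hx
    | succ k ih => rw [Function.iterate_succ_apply']; exact hT.mapsTo ih
  set W := Submodule.span K (Set.range fun k => P^[k] x) with hWdef
  have hWT : W ≤ T.toSubmodule := Submodule.span_le.2 (by rintro _ ⟨k, rfl⟩; exact hmem k)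
  have hcomm : ∀ u ∈ W, ∀ v ∈ W, ⁅u, v⁆ = 0 := by
    intro u hu v hv
    induction hu, hv using Submodule.span_induction₂ with
    | mem_mem u v hu hv =>
      obtain ⟨i, rfl⟩ := hu
      obtain ⟨j, rfl⟩ := hv
      exact hP.lie_iterate_eq_zero (hP.lie_iterate_self x j) i
    | zero_left => simp
    | zero_right => simp
    | add_left u v w _ _ _ hu hv => rw [add_lie, hu, hv, add_zero]
    | add_right u v w _ _ _ hu hv => rw [lie_add, hu, hv, add_zero]
    | smul_left c u v _ _ h => rw [smul_lie, h, smul_zero]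
    | smul_right c u v _ _ h => rw [lie_smul, h, smul_zero]
  have hPW : ∀ u ∈ W, P u ∈ Submodule.span K (Set.range fun k => P^[k + 1] x) := by
    intro u hu
    induction hu using Submodule.span_induction with
    | mem u hu =>
      obtain ⟨k, rfl⟩ := hu
      exact Submodule.subset_span ⟨k, Function.iterate_succ_apply' _ _ _⟩
    | zero => rw [hP.map_zero]; exact Submodule.zero_mem _
    | add u v hu hv ihu ihv =>
      rw [hP.map_add, hcomm u hu v hv, add_zero]
      exact Submodule.add_mem _ ihu ihv
    | smul c u hu ih =>
      rw [hP.map_smul]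
      exact Submodule.smul_mem _ _ ih
  have hle : Submodule.span K (Set.range fun k => P^[k + 1] x) ≤ W :=
    Submodule.span_mono (by rintro _ ⟨k, rfl⟩; exact ⟨k + 1, rfl⟩)
  have hx' : x ∈ Submodule.span K (Set.range fun k => P^[k + 1] x) := by
    have hxW : x ∈ W := Submodule.subset_span ⟨0, rfl⟩
    have h := hP.le_span_toral W (fun u hu => hle (hPW u hu)) hcomm
      (fun u hu h => IsTorus.eq_zero hP hT (hWT hu) h) hxW
    refine Submodule.span_le.2 ?_ h
    rintro t ⟨htW, ht⟩
    rw [← ht]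
    exact hPW t htW
  suffices H : ∀ u ∈ Submodule.span K (Set.range fun k => P^[k + 1] x), ⁅u, y⁆ = 0 from H x hx'
  intro u hu
  induction hu using Submodule.span_induction with
  | mem u hu =>
    obtain ⟨k, rfl⟩ := hu
    dsimp only
    rw [Function.iterate_succ_apply]
    refine hP.lie_iterate_eq_zero ?_ k
    rw [← LieAlgebra.ad_apply K g, hP.ad_map, sq]
    exact hy
  | zero => simp
  | add u v _ _ hu hv => rw [add_lie, hu, hv, add_zero]
  | smul c u _ h => rw [smul_lie, h, smul_zero]

/-- Tori are abelian: if `[x, z] = c z` with `c ≠ 0` then `(ad z)² x = 0`, so `[z, x] = 0` by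
semisimplicity of `z`. -/
theorem _root_.IsTorus.lie_eq_zero_of_mem (hP : IsTwoMap K P) (hT : IsTorus P T) {x y : g}
    (hx : x ∈ T) (hy : y ∈ T) : ⁅x, y⁆ = 0 := by
  by_contra hxy
  let R : Submodule K g := T.toSubmodule.map (LieAlgebra.ad K g x : g →ₗ[K] g)
  have hRT : R ≤ T.toSubmodule := by
    rintro _ ⟨z, hz, rfl⟩
    exact T.lie_mem hx hz
  have hR : ∀ z ∈ R, (LieAlgebra.ad K g x : g →ₗ[K] g) z ∈ R :=
    fun z hz => Submodule.mem_map_of_mem (hRT hz)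
  have : Nontrivial R := by
    refine ⟨⟨⟨⁅x, y⁆, Submodule.mem_map_of_mem (f := (LieAlgebra.ad K g x : g →ₗ[K] g)) hy⟩, 0, ?_⟩⟩
    exact fun h => hxy (congrArg Subtype.val h)
  obtain ⟨c, hc⟩ := Module.End.exists_eigenvalue ((LieAlgebra.ad K g x : g →ₗ[K] g).restrict hR)
  obtain ⟨z, hz⟩ := hc.exists_hasEigenvector
  have hz0 : (z : g) ≠ 0 := fun h => hz.2 (Subtype.ext h)
  have hxz : ⁅x, (z : g)⁆ = c • (z : g) := congrArg Subtype.val hz.apply_eq_smul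
  have hc0 : c ≠ 0 := by
    rintro rfl
    obtain ⟨w, hw, hwz⟩ := z.2
    rw [zero_smul, ← hwz] at hxz
    exact hz0 (hwz.symm.trans (IsTorus.lie_eq_zero hP hT hx hxz))
  have h : ⁅(z : g), x⁆ = 0 := by
    refine IsTorus.lie_eq_zero hP hT (hRT z.2) ?_
    rw [← lie_skew (z : g) x, hxz, lie_neg, lie_smul, lie_self, smul_zero, neg_zero]
  rw [← lie_skew, hxz, neg_eq_zero] at h
  exact (smul_ne_zero hc0 hz0) h

end Tori

section PolynomialCurves

variable (K : Type*) [Field K]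

/-- The curves `K → W` which are given by polynomials with coefficients in `W`. -/
def polynomialCurves (W : Type*) [AddCommGroup W] [Module K W] : Submodule K (K → W) :=
  Submodule.span K (Set.range fun p : ℕ × W => fun s => s ^ p.1 • p.2)

variable {K} {W W' : Type*} [AddCommGroup W] [Module K W] [AddCommGroup W'] [Module K W']

theorem comp_mem_polynomialCurves {c : K → W} (hc : c ∈ polynomialCurves K W) (f : W →ₗ[K] W') :
    (fun s => f (c s)) ∈ polynomialCurves K W' := by
  induction hc using Submodule.span_induction with
  | mem c hc =>
    obtain ⟨⟨n, v⟩, rfl⟩ := hc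
    exact Submodule.subset_span ⟨(n, f v), by simp⟩
  | zero => convert Submodule.zero_mem (polynomialCurves K W') using 1; ext s; simp
  | add c d _ _ hc hd => convert Submodule.add_mem _ hc hd using 1; ext s; simp
  | smul r c _ hc => convert Submodule.smul_mem _ r hc using 1; ext s; simp

theorem exists_eval_eq_of_mem_polynomialCurves {c : K → K} (hc : c ∈ polynomialCurves K K) :
    ∃ p : K[X], ∀ s, c s = p.eval s := by
  induction hc using Submodule.span_induction with
  | mem c hc =>
    obtain ⟨⟨n, v⟩, rfl⟩ := hc
    exact ⟨C v * X ^ n, fun s => by simp [mul_comm (s ^ n)]⟩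
  | zero => exact ⟨0, by simp⟩
  | add c d _ _ hc hd =>
    obtain ⟨p, hp⟩ := hc
    obtain ⟨q, hq⟩ := hd
    exact ⟨p + q, by simp [hp, hq]⟩
  | smul r c _ hc =>
    obtain ⟨p, hp⟩ := hc
    exact ⟨C r * p, by simp [hp]⟩

theorem exists_eval_eq_det {ι : Type*} [Fintype ι] [DecidableEq ι] (M : K → Matrix ι ι K)
    (hM : ∀ i j, (fun s => M s i j) ∈ polynomialCurves K K) :
    ∃ p : K[X], ∀ s, (M s).det = p.eval s := by
  choose p hp using fun i j => exists_eval_eq_of_mem_polynomialCurves (hM i j)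
  refine ⟨(Matrix.of p).det, fun s => ?_⟩
  rw [← coe_evalRingHom, RingHom.map_det]
  congr 1
  ext i j
  simp [hp]

variable {g : Type*} [LieRing g] [LieAlgebra K g] {P : g → g}

theorem lie_mem_polynomialCurves {c d : K → g} (hc : c ∈ polynomialCurves K g)
    (hd : d ∈ polynomialCurves K g) : (fun s => ⁅c s, d s⁆) ∈ polynomialCurves K g := by
  induction hc, hd using Submodule.span_induction₂ with
  | mem_mem c d hc hd =>
    obtain ⟨⟨m, u⟩, rfl⟩ := hc
    obtain ⟨⟨n, v⟩, rfl⟩ := hd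
    exact Submodule.subset_span ⟨(m + n, ⁅u, v⁆), by
      ext s; simp [smul_smul, pow_add, mul_comm]⟩
  | zero_left => convert Submodule.zero_mem (polynomialCurves K g) using 1; ext s; simp
  | zero_right => convert Submodule.zero_mem (polynomialCurves K g) using 1; ext s; simp
  | add_left u v w _ _ _ hu hv => convert Submodule.add_mem _ hu hv using 1; ext s; simp
  | add_right u v w _ _ _ hu hv => convert Submodule.add_mem _ hu hv using 1; ext s; simp
  | smul_left c u v _ _ h => convert Submodule.smul_mem _ c h using 1; ext s; simp
  | smul_right c u v _ _ h => convert Submodule.smul_mem _ c h using 1; ext s; simp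

theorem _root_.IsTwoMap.comp_mem_polynomialCurves (hP : IsTwoMap K P) {c : K → g}
    (hc : c ∈ polynomialCurves K g) : (fun s => P (c s)) ∈ polynomialCurves K g := by
  induction hc using Submodule.span_induction with
  | mem c hc =>
    obtain ⟨⟨n, v⟩, rfl⟩ := hc
    exact Submodule.subset_span ⟨(n * 2, P v), by ext s; simp [hP.map_smul, pow_mul]⟩
  | zero => convert Submodule.zero_mem (polynomialCurves K g) using 1; ext s; simp [hP.map_zero]
  | add c d hc hd ihc ihd =>
    have h := Submodule.add_mem _ (Submodule.add_mem _ ihc ihd) (lie_mem_polynomialCurves hc hd)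
    convert h using 1
    ext s
    exact hP.map_add _ _
  | smul r c _ hc =>
    convert Submodule.smul_mem _ (r ^ 2) hc using 1
    ext s
    exact hP.map_smul _ _

theorem _root_.IsTwoMap.iterate_mem_polynomialCurves (hP : IsTwoMap K P) {c : K → g}
    (hc : c ∈ polynomialCurves K g) (k : ℕ) : (fun s => P^[k] (c s)) ∈ polynomialCurves K g := by
  induction k with
  | zero => exact hc
  | succ k ih =>
    simp only [Function.iterate_succ_apply']
    exact hP.comp_mem_polynomialCurves ih

end PolynomialCurves

section ToralRank

variable {K g : Type*} [Field K] [CharP K 2] [IsAlgClosed K] [LieRing g] [LieAlgebra K g]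
  [FiniteDimensional K g] {P : g → g} {T : LieSubalgebra K g}

omit [CharP K 2] in
theorem exists_pow_two_pow_injective (n : ℕ) :
    ∃ u : K, Function.Injective fun k : Fin n => u ^ 2 ^ (k : ℕ) := by
  classical
  let q : K[X] := ∏ j : Fin n, ∏ k ∈ Finset.univ.erase j, (X ^ 2 ^ (j : ℕ) - X ^ 2 ^ (k : ℕ))
  have hq : q ≠ 0 := by
    refine Finset.prod_ne_zero_iff.2 fun j _ => Finset.prod_ne_zero_iff.2 fun k hk => ?_
    rw [sub_ne_zero]
    intro h
    have h' := congrArg natDegree h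
    rw [natDegree_X_pow, natDegree_X_pow] at h'
    exact (Finset.mem_erase.1 hk).1 (Fin.ext (Nat.pow_right_injective le_rfl h').symm)
  obtain ⟨u, hu⟩ : ∃ u, q.eval u ≠ 0 := by
    by_contra! h
    exact hq (funext fun u => by simpa using h u)
  refine ⟨u, fun j k hjk => ?_⟩
  by_contra hne
  apply hu
  rw [eval_prod]
  refine Finset.prod_eq_zero (Finset.mem_univ j) ?_
  rw [eval_prod]
  refine Finset.prod_eq_zero (Finset.mem_erase.2 ⟨Ne.symm hne, Finset.mem_univ k⟩) ?_
  simpa [sub_eq_zero] using hjk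

/-- With toral elements `t_i` spanning the torus, the iterates of `∑ u ^ i • t_i` are independent as
soon as the powers `u ^ 2 ^ k` are distinct. -/
theorem _root_.IsTorus.exists_linearIndependent_iterate (hP : IsTwoMap K P) (hT : IsTorus P T)
    {n : ℕ} (hn : n ≤ finrank K T) :
    ∃ x ∈ T, LinearIndependent K fun k : Fin n => P^[k] x := by
  set s : Set g := {t | t ∈ T.toSubmodule ∧ P t = t}
  have hspan : Submodule.span K s = T.toSubmodule := by
    refine le_antisymm (Submodule.span_le.2 fun t ht => ht.1) ?_
    exact hP.le_span_toral T.toSubmodule (fun x hx => hT.mapsTo hx)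
      (fun x hx y hy => IsTorus.lie_eq_zero_of_mem hP hT hx hy)
      (fun x hx => IsTorus.eq_zero hP hT hx)
  obtain ⟨t, hts, -, htli⟩ := Submodule.exists_fun_fin_finrank_span_eq K s
  have hle : n ≤ finrank K (Submodule.span K s) := hspan ▸ hn
  obtain ⟨u, hu⟩ := exists_pow_two_pow_injective (K := K) n
  let τ : Fin n → g := fun i => t (Fin.castLE hle i)
  have hτ : LinearIndependent K τ := htli.comp _ (Fin.castLE_injective hle)
  have hτT : ∀ i, τ i ∈ T := fun i => (hts _).1
  have hit : ∀ k : ℕ, P^[k] (∑ i : Fin n, u ^ (i : ℕ) • τ i) =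
      ∑ i : Fin n, (u ^ 2 ^ k) ^ (i : ℕ) • τ i := by
    intro k
    induction k with
    | zero => simp
    | succ k ih =>
      rw [Function.iterate_succ_apply', ih]
      have hsum : ∀ S : Finset (Fin n), P (∑ i ∈ S, (u ^ 2 ^ k) ^ (i : ℕ) • τ i) =
          ∑ i ∈ S, (u ^ 2 ^ (k + 1)) ^ (i : ℕ) • τ i := by
        classical
        intro S
        induction S using Finset.induction_on with
        | empty => simpa using hP.map_zero
        | insert i S hi ih =>
          rw [Finset.sum_insert hi, Finset.sum_insert hi, hP.map_add, ih, hP.map_smul,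
            show P (τ i) = τ i from (hts _).2,
            IsTorus.lie_eq_zero_of_mem hP hT (T.smul_mem _ (hτT i))
              (T.sum_mem fun j _ => T.smul_mem _ (hτT j)), add_zero]
          congr 2
          ring
      exact hsum _
  refine ⟨∑ i : Fin n, u ^ (i : ℕ) • τ i, T.sum_mem fun i _ => T.smul_mem _ (hτT i), ?_⟩
  -- in the basis `τ` the iterates are the rows of a Vandermonde matrix
  simp only [hit]
  rw [Fintype.linearIndependent_iff]
  intro c hc
  have hdet := Matrix.det_vandermonde_ne_zero_iff.2 hu
  have h0 : c = 0 := by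
    refine Matrix.eq_zero_of_vecMul_eq_zero hdet (funext fun i => ?_)
    refine Fintype.linearIndependent_iff.1 hτ
      (Matrix.vecMul c (Matrix.vandermonde fun k : Fin n => u ^ 2 ^ (k : ℕ))) ?_ i
    rw [← hc]
    simp only [Matrix.vecMul, dotProduct, Matrix.vandermonde_apply, Finset.sum_smul,
      Finset.smul_sum, smul_smul]
    exact Finset.sum_comm
  exact fun i => congrFun h0 i

/-- The toral rank is at most the dimension of the centralizer of any element `y`. If `x` lies in a
torus of larger dimension, join `y` to `x` by the line `z s`. For almost all `s` the centralizer of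
`z s` has at most the dimension of that of `y`, but contains the iterates of `z s` under the
`2`-map, which are independent for almost all `s` because they are so at `x`. -/
theorem _root_.IsTorus.finrank_le (hP : IsTwoMap K P) (hT : IsTorus P T) (y : g) :
    finrank K T ≤ finrank K (LinearMap.ker (LieAlgebra.ad K g y : g →ₗ[K] g)) := by
  set N : Submodule K g := LinearMap.ker (LieAlgebra.ad K g y : g →ₗ[K] g)
  by_contra! hlt
  set n := finrank K N with hn
  obtain ⟨x, -, hx⟩ := IsTorus.exists_linearIndependent_iterate hP hT (Nat.succ_le_of_lt hlt)
  let z : K → g := fun s => y + s • (x - y)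
  have hz0 : z 0 = y := by simp [z]
  have hz1 : z 1 = x := by simp [z]
  have hz : z ∈ polynomialCurves K g := by
    have h : z = (fun s : K => s ^ 0 • y) + fun s : K => s ^ 1 • (x - y) := by
      ext s
      simp [z]
    rw [h]
    exact Submodule.add_mem _ (Submodule.subset_span ⟨(0, y), rfl⟩)
      (Submodule.subset_span ⟨(1, x - y), rfl⟩)
  -- near `s = 0` the centralizer of `z s` is no larger than that of `y`
  obtain ⟨π, hπ⟩ := N.subtype.exists_leftInverse_of_injective N.ker_subtype
  let D : g → g →ₗ[K] g × N := fun w => (LieAlgebra.ad K g w : g →ₗ[K] g).prod π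
  obtain ⟨ρ, hρ⟩ := (D y).exists_leftInverse_of_injective (by
    rw [LinearMap.ker_prod, eq_bot_iff]
    rintro w ⟨hw, hw'⟩
    have h : π w = (⟨w, hw⟩ : N) := LinearMap.congr_fun hπ ⟨w, hw⟩
    rw [SetLike.mem_coe, LinearMap.mem_ker, h] at hw'
    exact congrArg Subtype.val hw')
  let bg := Module.finBasis K g
  obtain ⟨p, hp⟩ := exists_eval_eq_det
    (fun s => LinearMap.toMatrix bg bg (ρ ∘ₗ D (z s))) (by
      intro i j
      have h1 : (fun s => ρ (D (z s) (bg j))) ∈ polynomialCurves K g := by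
        convert Submodule.add_mem _
          (comp_mem_polynomialCurves hz (ρ ∘ₗ LinearMap.inl K g N ∘ₗ
            (-(LieAlgebra.ad K g (bg j) : g →ₗ[K] g))))
          (Submodule.subset_span ⟨(0, ρ (0, π (bg j))), rfl⟩) using 1
        ext s
        change ρ (⁅z s, bg j⁆, π (bg j)) = ρ (-⁅bg j, z s⁆, 0) + s ^ 0 • ρ (0, π (bg j))
        rw [lie_skew, pow_zero, one_smul, ← map_add, Prod.mk_add_mk, add_zero, zero_add]
      simpa [LinearMap.toMatrix_apply] using comp_mem_polynomialCurves h1 (bg.coord i))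
  have hp0 : p.eval 0 ≠ 0 := by
    rw [← hp, hz0, hρ, LinearMap.toMatrix_id, Matrix.det_one]
    exact one_ne_zero
  -- near `s = 1` the first iterates of `z s` are linearly independent
  obtain ⟨ψ, hψ⟩ := (Fintype.linearCombination K
    (fun k : Fin (n + 1) => P^[k] x)).exists_leftInverse_of_injective
      (LinearMap.ker_eq_bot.2 hx.fintypeLinearCombination_injective)
  obtain ⟨q, hq⟩ := exists_eval_eq_det
    (fun s => Matrix.of fun k j : Fin (n + 1) => ψ (P^[k] (z s)) j) (by
      intro k j
      exact comp_mem_polynomialCurves (hP.iterate_mem_polynomialCurves hz k)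
        (LinearMap.proj j ∘ₗ ψ))
  have hq1 : q.eval 1 ≠ 0 := by
    rw [← hq, hz1]
    have : (Matrix.of fun k j : Fin (n + 1) => ψ (P^[k] x) j) = 1 := by
      ext k j
      have h := LinearMap.congr_fun hψ (Pi.single k 1)
      rw [LinearMap.comp_apply, Fintype.linearCombination_apply_single, one_smul] at h
      rw [Matrix.of_apply, h, Matrix.one_apply, LinearMap.id_apply, Pi.single_apply]
      simp only [eq_comm]
    rw [this, Matrix.det_one]
    exact one_ne_zero
  obtain ⟨s, hs⟩ : ∃ s, (p * q).eval s ≠ 0 := by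
    by_contra! h
    have h0 : p * q = 0 := funext fun u => by simpa using h u
    rcases mul_eq_zero.1 h0 with h | h
    · exact hp0 (by simp [h])
    · exact hq1 (by simp [h])
  rw [eval_mul] at hs
  have hps := left_ne_zero_of_mul hs
  have hqs := right_ne_zero_of_mul hs
  rw [← hp] at hps
  rw [← hq] at hqs
  have hli : LinearIndependent K fun k : Fin (n + 1) => π (P^[k] (z s)) := by
    rw [Fintype.linearIndependent_iff]
    intro c hc
    set w := ∑ k, c k • P^[k] (z s) with hw
    have hπw : π w = 0 := by rw [hw, map_sum, ← hc]; simp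
    have hzw : ⁅z s, w⁆ = 0 := by
      rw [hw, lie_sum]
      exact Finset.sum_eq_zero fun k _ => by rw [lie_smul, hP.lie_iterate_self, smul_zero]
    have hDw : (ρ ∘ₗ D (z s)) w = 0 := by
      rw [LinearMap.comp_apply]
      have : D (z s) w = 0 := Prod.ext hzw hπw
      rw [this, map_zero]
    have hw0 : w = 0 := by
      have hM : (LinearMap.toMatrix bg bg (ρ ∘ₗ D (z s))).mulVec (bg.repr w) = 0 := by
        rw [LinearMap.toMatrix_mulVec_repr, hDw]
        simp
      exact bg.repr.map_eq_zero_iff.1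
        (DFunLike.coe_injective (Matrix.eq_zero_of_mulVec_eq_zero hps hM))
    have hc0 : c = 0 := by
      refine Matrix.eq_zero_of_vecMul_eq_zero hqs (funext fun j => ?_)
      have h : ψ w j = 0 := by rw [hw0, map_zero, Pi.zero_apply]
      rw [hw, map_sum, Finset.sum_apply] at h
      simpa [Matrix.vecMul, dotProduct] using h
    exact fun k => congrFun hc0 k
  have hcard := hli.fintype_card_le_finrank
  rw [Fintype.card_fin] at hcard
  omega

end ToralRank

end WeisfeilerKac

/-! ### The local part and the radical of a contragredient Lie algebra -/

namespace Contragredient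

open Module

variable {K ι : Type*} [Field K] [DecidableEq ι] (A : Matrix ι ι K)

section Generation

/-- The generators generate `G̃(A)`. -/
theorem eq_top_of_gen_mem (S : LieSubalgebra K (Tilde A)) (h : ∀ x, Tilde.gen A x ∈ S) :
    S = ⊤ := by
  let mk : FreeLieAlgebra K (Gen ι) →ₗ⁅K⁆ Tilde A :=
    { (LieSubmodule.Quotient.mk' (relationIdeal A) : FreeLieAlgebra K (Gen ι) →ₗ[K] Tilde A) with
      map_lie' := fun {_ _} => rfl }
  have hmk : S.incl.comp (FreeLieAlgebra.lift K fun x => (⟨Tilde.gen A x, h x⟩ : S)) = mk := by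
    refine FreeLieAlgebra.hom_ext fun x => ?_
    rw [LieHom.comp_apply, FreeLieAlgebra.lift_of_apply]
    rfl
  rw [eq_top_iff]
  intro x _
  obtain ⟨x, rfl⟩ := LieSubmodule.Quotient.surjective_mk' (relationIdeal A) x
  have hx : mk x ∈ S := by
    rw [← hmk]
    exact Subtype.property _
  exact hx

theorem span_isMonomial_eq_top :
    Submodule.span K {x | ∃ n, IsMonomial A n x} = (⊤ : Submodule K (Tilde A)) := by
  let S : LieSubalgebra K (Tilde A) :=
    { Submodule.span K {x | ∃ n, IsMonomial A n x} with
      lie_mem' := by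
        intro x y hx hy
        change x ∈ Submodule.span K _ at hx
        change y ∈ Submodule.span K _ at hy
        change ⁅x, y⁆ ∈ Submodule.span K _
        induction hx, hy using Submodule.span_induction₂ with
        | mem_mem x y hx hy =>
          obtain ⟨m, hm⟩ := hx
          obtain ⟨n, hn⟩ := hy
          exact Submodule.subset_span ⟨_, hm.lie hn⟩
        | zero_left => simp
        | zero_right => simp
        | add_left x y z _ _ _ hx hy => rw [add_lie]; exact Submodule.add_mem _ hx hy
        | add_right x y z _ _ _ hx hy => rw [lie_add]; exact Submodule.add_mem _ hx hy
        | smul_left c x y _ _ h => rw [smul_lie]; exact Submodule.smul_mem _ _ h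
        | smul_right c x y _ _ h => rw [lie_smul]; exact Submodule.smul_mem _ _ h }
  have h := eq_top_of_gen_mem A S fun x => by
    cases x with
    | e i => exact Submodule.subset_span ⟨_, .e i⟩
    | f i => exact Submodule.subset_span ⟨_, .f i⟩
    | h i => exact Submodule.subset_span ⟨_, .h i⟩
  exact congrArg LieSubalgebra.toSubmodule h

theorem iSup_component : ⨆ n, component A n = ⊤ := by
  rw [eq_top_iff, ← span_isMonomial_eq_top, Submodule.span_le]
  rintro x ⟨n, hn⟩
  exact Submodule.mem_iSup_of_mem n (Submodule.subset_span hn)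

/-- Every element is the sum of its homogeneous components. -/
theorem exists_sum_proj (x : Tilde A) : ∃ s : Finset ℤ, x = ∑ n ∈ s, proj A n x ∧
    ∀ n, proj A n x ∈ component A n := by
  have hx : x ∈ ⨆ n, component A n := iSup_component A ▸ Submodule.mem_top
  obtain ⟨c, hc, rfl⟩ := (Submodule.mem_iSup_iff_exists_finsupp _ _).1 hx
  have hproj : ∀ n, proj A n (c.sum fun _ y => y) = c n := by
    intro n
    rw [Finsupp.sum, map_sum]
    simp only [proj_of_mem A (hc _), Finset.sum_ite_eq']
    split_ifs with h
    · rfl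
    · exact (Finsupp.notMem_support_iff.1 h).symm
  exact ⟨c.support, by simp only [hproj]; rfl, fun n => hproj n ▸ hc n⟩

end Generation

section Triangular

omit [DecidableEq ι] in
/-- If `H` maps each `e_i` to multiples of itself and each `[f_j, e_i]` lies in `H`, then the
subalgebra `N` generated by `e` is stable under `H`, and every `f_j` maps it into `H + N`. -/
theorem lie_mem_of_mem_lieSpan {L : Type*} [LieRing L] [LieAlgebra K L] {e f : ι → L}
    {H : Submodule K L} (hH : ∀ h ∈ H, ∀ i, ⁅h, e i⁆ ∈ Submodule.span K {e i})
    (hf : ∀ i j, ⁅f j, e i⁆ ∈ H) {x : L} (hx : x ∈ LieSubalgebra.lieSpan K L (Set.range e)) :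
    (∀ h ∈ H, ⁅h, x⁆ ∈ LieSubalgebra.lieSpan K L (Set.range e)) ∧
    ∀ j, ⁅f j, x⁆ ∈ H ⊔ (LieSubalgebra.lieSpan K L (Set.range e)).toSubmodule := by
  set N := LieSubalgebra.lieSpan K L (Set.range e)
  induction hx using LieSubalgebra.lieSpan_induction with
  | mem x hx =>
    obtain ⟨i, rfl⟩ := hx
    refine ⟨fun h hh => ?_, fun j => Submodule.mem_sup_left (hf i j)⟩
    refine Submodule.span_le.2 ?_ (hH h hh i)
    rintro _ rfl
    exact LieSubalgebra.subset_lieSpan ⟨i, rfl⟩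
  | zero => simp
  | add x y _ _ hx hy =>
    refine ⟨fun h hh => ?_, fun j => ?_⟩
    · rw [lie_add]; exact N.add_mem (hx.1 h hh) (hy.1 h hh)
    · rw [lie_add]; exact Submodule.add_mem _ (hx.2 j) (hy.2 j)
  | smul c x _ hx =>
    refine ⟨fun h hh => ?_, fun j => ?_⟩
    · rw [lie_smul]; exact N.smul_mem _ (hx.1 h hh)
    · rw [lie_smul]; exact Submodule.smul_mem _ _ (hx.2 j)
  | lie x y hxN hyN hx hy =>
    have key : ∀ {x y : L}, (∀ h ∈ H, ⁅h, y⁆ ∈ N) → y ∈ N →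
        x ∈ H ⊔ N.toSubmodule → ⁅x, y⁆ ∈ N := by
      intro x y hy hyN hx
      obtain ⟨h, hh, u, hu, rfl⟩ := Submodule.mem_sup.1 hx
      rw [add_lie]
      exact N.add_mem (hy h hh) (N.lie_mem hu hyN)
    refine ⟨fun h hh => ?_, fun j => Submodule.mem_sup_right ?_⟩
    · rw [leibniz_lie]
      exact N.add_mem (N.lie_mem (hx.1 h hh) hyN) (N.lie_mem hxN (hy.1 h hh))
    · rw [leibniz_lie]
      refine N.add_mem (key hy.1 hyN (hx.2 j)) ?_
      rw [← lie_skew]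
      exact N.neg_mem (key hx.1 hxN (hy.2 j))

/-- The triangular decomposition of `G̃(A)`, without directness of the sum. -/
theorem exists_triangular (x : Tilde A) :
    ∃ h ∈ Submodule.span K (Set.range fun i => Tilde.gen A (Gen.h i)),
    ∃ p ∈ LieSubalgebra.lieSpan K (Tilde A) (Set.range fun i => Tilde.gen A (Gen.e i)),
    ∃ m ∈ LieSubalgebra.lieSpan K (Tilde A) (Set.range fun i => Tilde.gen A (Gen.f i)),
      x = h + p + m := by
  set H := Submodule.span K (Set.range fun i => Tilde.gen A (Gen.h i)) with hHdef
  set N := LieSubalgebra.lieSpan K (Tilde A) (Set.range fun i => Tilde.gen A (Gen.e i))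
  set M := LieSubalgebra.lieSpan K (Tilde A) (Set.range fun i => Tilde.gen A (Gen.f i))
  have hHe : ∀ h ∈ H, ∀ i, ⁅h, Tilde.gen A (Gen.e i)⁆ ∈
      Submodule.span K {Tilde.gen A (Gen.e i)} := by
    intro h hh i
    induction hh using Submodule.span_induction with
    | mem h hh =>
      obtain ⟨j, rfl⟩ := hh
      rw [Tilde.gen_he]
      exact Submodule.smul_mem _ _ (Submodule.mem_span_singleton_self _)
    | zero => simp
    | add x y _ _ hx hy => rw [add_lie]; exact Submodule.add_mem _ hx hy
    | smul c x _ hx => rw [smul_lie]; exact Submodule.smul_mem _ _ hx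
  have hHf : ∀ h ∈ H, ∀ i, ⁅h, Tilde.gen A (Gen.f i)⁆ ∈
      Submodule.span K {Tilde.gen A (Gen.f i)} := by
    intro h hh i
    induction hh using Submodule.span_induction with
    | mem h hh =>
      obtain ⟨j, rfl⟩ := hh
      rw [Tilde.gen_hf]
      exact Submodule.neg_mem _ (Submodule.smul_mem _ _ (Submodule.mem_span_singleton_self _))
    | zero => simp
    | add x y _ _ hx hy => rw [add_lie]; exact Submodule.add_mem _ hx hy
    | smul c x _ hx => rw [smul_lie]; exact Submodule.smul_mem _ _ hx
  have hef : ∀ i j, ⁅Tilde.gen A (Gen.e j), Tilde.gen A (Gen.f i)⁆ ∈ H := by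
    intro i j
    rw [Tilde.gen_ef]
    split_ifs
    · exact Submodule.subset_span ⟨i, rfl⟩
    · exact H.zero_mem
  have hfe : ∀ i j, ⁅Tilde.gen A (Gen.f j), Tilde.gen A (Gen.e i)⁆ ∈ H := by
    intro i j
    rw [← lie_skew]
    exact H.neg_mem (hef j i)
  have hHH : ∀ h ∈ H, ∀ h' ∈ H, ⁅h, h'⁆ = 0 := by
    intro h hh h' hh'
    induction hh, hh' using Submodule.span_induction₂ with
    | mem_mem x y hx hy =>
      obtain ⟨i, rfl⟩ := hx
      obtain ⟨j, rfl⟩ := hy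
      exact Tilde.gen_hh A i j
    | zero_left => simp
    | zero_right => simp
    | add_left x y z _ _ _ hx hy => rw [add_lie, hx, hy, add_zero]
    | add_right x y z _ _ _ hx hy => rw [lie_add, hx, hy, add_zero]
    | smul_left c x y _ _ h => rw [smul_lie, h, smul_zero]
    | smul_right c x y _ _ h => rw [lie_smul, h, smul_zero]
  have heN : ∀ i, Tilde.gen A (Gen.e i) ∈ N := fun i => LieSubalgebra.subset_lieSpan ⟨i, rfl⟩
  have hfM : ∀ i, Tilde.gen A (Gen.f i) ∈ M := fun i => LieSubalgebra.subset_lieSpan ⟨i, rfl⟩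
  set U : Submodule K (Tilde A) := H ⊔ N.toSubmodule ⊔ M.toSubmodule
  have hHU : H ≤ U := le_sup_left.trans le_sup_left
  have hNU : N.toSubmodule ≤ U := le_sup_right.trans le_sup_left
  have hMU : M.toSubmodule ≤ U := le_sup_right
  -- the stabilizer of `U` contains the generators
  let S : LieSubalgebra K (Tilde A) :=
    { carrier := {z | ∀ u ∈ U, ⁅z, u⁆ ∈ U}
      add_mem' := fun hx hy u hu => by rw [add_lie]; exact U.add_mem (hx u hu) (hy u hu)
      zero_mem' := fun u _ => by rw [zero_lie]; exact U.zero_mem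
      smul_mem' := fun c x hx u hu => by rw [smul_lie]; exact U.smul_mem _ (hx u hu)
      lie_mem' := fun hx hy u hu => by
        rw [lie_lie]; exact U.sub_mem (hx _ (hy u hu)) (hy _ (hx u hu)) }
  have hS : ∀ z, (∀ h ∈ H, ⁅z, h⁆ ∈ U) → (∀ p ∈ N, ⁅z, p⁆ ∈ U) → (∀ m ∈ M, ⁅z, m⁆ ∈ U) →
      z ∈ S := by
    intro z h1 h2 h3 u hu
    obtain ⟨v, hv, m, hm, rfl⟩ := Submodule.mem_sup.1 hu
    obtain ⟨h, hh, p, hp, rfl⟩ := Submodule.mem_sup.1 hv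
    rw [lie_add, lie_add]
    exact U.add_mem (U.add_mem (h1 h hh) (h2 p hp)) (h3 m hm)
  have hStop : S = ⊤ := by
    refine eq_top_of_gen_mem A S fun x => ?_
    cases x with
    | e i =>
      refine hS _ (fun h hh => ?_) (fun p hp => hNU (N.lie_mem (heN i) hp)) (fun m hm => ?_)
      · rw [← lie_skew]
        exact U.neg_mem (hNU ((lie_mem_of_mem_lieSpan hHe hfe (heN i)).1 h hh))
      · exact sup_le hHU hMU ((lie_mem_of_mem_lieSpan hHf hef hm).2 i)
    | f i =>
      refine hS _ (fun h hh => ?_) (fun p hp => ?_) (fun m hm => hMU (M.lie_mem (hfM i) hm))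
      · rw [← lie_skew]
        exact U.neg_mem (hMU ((lie_mem_of_mem_lieSpan hHf hef (hfM i)).1 h hh))
      · exact sup_le hHU hNU ((lie_mem_of_mem_lieSpan hHe hfe hp).2 i)
    | h i =>
      have hi : Tilde.gen A (Gen.h i) ∈ H := Submodule.subset_span ⟨i, rfl⟩
      exact hS _ (fun h hh => hHH _ hi h hh ▸ U.zero_mem)
        (fun p hp => hNU ((lie_mem_of_mem_lieSpan hHe hfe hp).1 _ hi))
        (fun m hm => hMU ((lie_mem_of_mem_lieSpan hHf hef hm).1 _ hi))
  let U' : LieSubalgebra K (Tilde A) :=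
    { U with lie_mem' := fun {x} _ _ hy => (hStop ▸ LieSubalgebra.mem_top x : x ∈ S) _ hy }
  have hU' : U' = ⊤ := by
    refine eq_top_of_gen_mem A U' fun x => ?_
    cases x with
    | e i => exact hNU (heN i)
    | f i => exact hMU (hfM i)
    | h i => exact hHU (Submodule.subset_span ⟨i, rfl⟩)
  have hx : x ∈ U' := hU' ▸ LieSubalgebra.mem_top x
  obtain ⟨v, hv, m, hm, rfl⟩ := Submodule.mem_sup.1 (show x ∈ U from hx)
  obtain ⟨h, hh, p, hp, rfl⟩ := Submodule.mem_sup.1 hv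
  exact ⟨h, hh, p, hp, m, hm, rfl⟩

/-- The subalgebra generated by the `e_i` (`ε = 1`) or the `f_i` (`ε = -1`) is concentrated in
degrees of sign `ε`, and in degree `ε` it is spanned by these generators. -/
theorem proj_of_mem_lieSpan {ε : ℤ} (hε : ε = 1 ∨ ε = -1) {g : ι → Tilde A}
    (hg : ∀ i, IsMonomial A ε (g i)) {x : Tilde A}
    (hx : x ∈ LieSubalgebra.lieSpan K (Tilde A) (Set.range g)) :
    proj A ε x ∈ Submodule.span K (Set.range g) ∧ ∀ n, ε * n ≤ 0 → proj A n x = 0 := by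
  set Q : Submodule K (Tilde A) :=
    Submodule.span K (Set.range g ∪ {x | ∃ n, 2 ≤ ε * n ∧ IsMonomial A n x}) with hQ
  have hε2 : ε * ε = 1 := by rcases hε with rfl | rfl <;> norm_num
  have hmon : ∀ x ∈ Set.range g ∪ {x | ∃ n, 2 ≤ ε * n ∧ IsMonomial A n x},
      ∃ n, 1 ≤ ε * n ∧ IsMonomial A n x := by
    rintro _ (⟨i, rfl⟩ | ⟨n, hn, hx⟩)
    · exact ⟨ε, hε2.ge, hg i⟩
    · exact ⟨n, by omega, hx⟩
  let Q' : LieSubalgebra K (Tilde A) :=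
    { Q with
      lie_mem' := by
        intro x y hx hy
        change x ∈ Q at hx
        change y ∈ Q at hy
        change ⁅x, y⁆ ∈ Q
        induction hx, hy using Submodule.span_induction₂ with
        | mem_mem x y hx hy =>
          obtain ⟨m, hm, hx⟩ := hmon x hx
          obtain ⟨n, hn, hy⟩ := hmon y hy
          exact Submodule.subset_span (Or.inr ⟨m + n, by rw [mul_add]; omega, hx.lie hy⟩)
        | zero_left => simp
        | zero_right => simp
        | add_left x y z _ _ _ hx hy => rw [add_lie]; exact Submodule.add_mem _ hx hy
        | add_right x y z _ _ _ hx hy => rw [lie_add]; exact Submodule.add_mem _ hx hy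
        | smul_left c x y _ _ h => rw [smul_lie]; exact Submodule.smul_mem _ _ h
        | smul_right c x y _ _ h => rw [lie_smul]; exact Submodule.smul_mem _ _ h }
  have hxQ : x ∈ Q := by
    have h : LieSubalgebra.lieSpan K (Tilde A) (Set.range g) ≤ Q' :=
      LieSubalgebra.lieSpan_le.2 fun y hy => Submodule.subset_span (Or.inl hy)
    exact h hx
  clear hx
  induction hxQ using Submodule.span_induction with
  | mem x hx =>
    constructor
    · rcases hx with ⟨i, rfl⟩ | ⟨n, hn, hx⟩
      · rw [proj_of_mem A (Submodule.subset_span (hg i)), if_pos rfl]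
        exact Submodule.subset_span ⟨i, rfl⟩
      · rw [proj_of_mem A (Submodule.subset_span hx), if_neg]
        · exact Submodule.zero_mem _
        · rintro rfl
          omega
    · intro n hn
      obtain ⟨m, hm, hx⟩ := hmon x hx
      rw [proj_of_mem A (Submodule.subset_span hx), if_neg]
      rintro rfl
      omega
  | zero => exact ⟨by simp, by simp⟩
  | add x y _ _ hx hy =>
    refine ⟨by rw [map_add]; exact Submodule.add_mem _ hx.1 hy.1, fun n hn => ?_⟩
    rw [map_add, hx.2 n hn, hy.2 n hn, add_zero]
  | smul c x _ hx =>
    refine ⟨by rw [map_smul]; exact Submodule.smul_mem _ _ hx.1, fun n hn => ?_⟩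
    rw [map_smul, hx.2 n hn, smul_zero]

/-- The local part of `G̃(A)` is spanned by the generators. -/
theorem component_local :
    component A 0 ≤ Submodule.span K (Set.range fun i => Tilde.gen A (Gen.h i)) ∧
    component A 1 ≤ Submodule.span K (Set.range fun i => Tilde.gen A (Gen.e i)) ∧
    component A (-1) ≤ Submodule.span K (Set.range fun i => Tilde.gen A (Gen.f i)) := by
  have hH : Submodule.span K (Set.range fun i => Tilde.gen A (Gen.h i)) ≤ component A 0 :=
    Submodule.span_le.2 (by rintro _ ⟨i, rfl⟩; exact Submodule.subset_span (.h i))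
  have hpos := fun {x} =>
    proj_of_mem_lieSpan A (ε := 1) (Or.inl rfl) (IsMonomial.e (A := A)) (x := x)
  have hneg := fun {x} =>
    proj_of_mem_lieSpan A (ε := -1) (Or.inr rfl) (IsMonomial.f (A := A)) (x := x)
  refine ⟨fun x hx => ?_, fun x hx => ?_, fun x hx => ?_⟩ <;>
    obtain ⟨h, hh, p, hp, m, hm, rfl⟩ := exists_triangular A x
  · have hx' := proj_of_mem A hx 0
    rw [if_pos rfl, map_add, map_add, proj_of_mem A (hH hh), if_pos rfl,
      (hpos hp).2 0 (by norm_num), (hneg hm).2 0 (by norm_num), add_zero, add_zero] at hx'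
    rwa [← hx']
  · have hx' := proj_of_mem A hx 1
    rw [if_pos rfl, map_add, map_add, proj_of_mem A (hH hh), if_neg (by norm_num),
      (hneg hm).2 1 (by norm_num), zero_add, add_zero] at hx'
    rw [← hx']
    exact (hpos hp).1
  · have hx' := proj_of_mem A hx (-1)
    rw [if_pos rfl, map_add, map_add, proj_of_mem A (hH hh), if_neg (by norm_num),
      (hpos hp).2 (-1) (by norm_num), zero_add, zero_add] at hx'
    rw [← hx']
    exact (hneg hm).1

end Triangular

section Radical

variable {A} {L κ : Type*} [LieRing L] [LieAlgebra K L]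

/-- The homomorphism from `G̃(A)` given by images of the generators which satisfy the relations. -/
noncomputable def Tilde.lift (φ : Gen ι → L)
    (hφ : ∀ x, IsRelator A x → FreeLieAlgebra.lift K φ x = 0) :
    Tilde A →ₗ⁅K⁆ L where
  __ := (relationIdeal A).toSubmodule.liftQ
    (FreeLieAlgebra.lift K φ : FreeLieAlgebra K (Gen ι) →ₗ[K] L) (by
      have h : relationIdeal A ≤ (FreeLieAlgebra.lift K φ).ker :=
        LieSubmodule.lieSpan_le.2 fun x hx => LieHom.mem_ker.2 (hφ x hx)
      exact fun x hx => LinearMap.mem_ker.2 (LieHom.mem_ker.1 (h hx)))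
  map_lie' := by
    intro x y
    obtain ⟨x, rfl⟩ := LieSubmodule.Quotient.surjective_mk' (relationIdeal A) x
    obtain ⟨y, rfl⟩ := LieSubmodule.Quotient.surjective_mk' (relationIdeal A) y
    exact LieHom.map_lie (FreeLieAlgebra.lift K φ) x y

theorem Tilde.lift_gen (φ : Gen ι → L)
    (hφ : ∀ x, IsRelator A x → FreeLieAlgebra.lift K φ x = 0) (x : Gen ι) :
    Tilde.lift φ hφ (Tilde.gen A x) = φ x :=
  FreeLieAlgebra.lift_of_apply (R := K) φ x

variable (π : Tilde A →ₗ⁅K⁆ L) (b : Basis κ K L) (deg : κ → ℤ)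

/-- A homomorphism which respects the degrees of monomials commutes with the projections onto
components. The grading of the target is given by degrees of its basis vectors. -/
theorem repr_map_proj (hdeg : ∀ n x, IsMonomial A n x → ∀ k, deg k ≠ n → b.repr (π x) k = 0)
    (n : ℤ) (x : Tilde A) (k : κ) :
    b.repr (π (proj A n x)) k = if deg k = n then b.repr (π x) k else 0 := by
  have hx : x ∈ Submodule.span K {x | ∃ n, IsMonomial A n x} :=
    span_isMonomial_eq_top A ▸ Submodule.mem_top
  induction hx using Submodule.span_induction with
  | mem x hx =>
    obtain ⟨m, hm⟩ := hx
    rw [proj_of_mem A (Submodule.subset_span hm)]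
    by_cases hmn : m = n
    · subst hmn
      rw [if_pos rfl]
      split_ifs with h
      · rfl
      · exact hdeg m x hm k h
    · rw [if_neg hmn, map_zero, map_zero, Finsupp.zero_apply]
      split_ifs with h
      · exact (hdeg m x hm k (by omega)).symm
      · rfl
  | zero => simp
  | add x y _ _ hx hy =>
    rw [map_add, map_add, map_add, Finsupp.add_apply, hx, hy, map_add, map_add, Finsupp.add_apply]
    split_ifs <;> simp
  | smul c x _ hx =>
    rw [map_smul, map_smul, map_smul, Finsupp.smul_apply, hx, map_smul, map_smul,
      Finsupp.smul_apply]
    split_ifs <;> simp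

theorem ker_mem_admissibleIdeals
    (hdeg : ∀ n x, IsMonomial A n x → ∀ k, deg k ≠ n → b.repr (π x) k = 0)
    (he : LinearIndependent K fun i => π (Tilde.gen A (Gen.e i)))
    (hf : LinearIndependent K fun i => π (Tilde.gen A (Gen.f i)))
    (hh : LinearIndependent K fun i => π (Tilde.gen A (Gen.h i))) :
    π.ker ∈ admissibleIdeals A := by
  have hker : ∀ x ∈ π.ker, ∀ n, proj A n x ∈ π.ker := by
    intro x hx n
    rw [LieHom.mem_ker] at hx ⊢
    refine b.repr.injective (Finsupp.ext fun k => ?_)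
    rw [repr_map_proj π b deg hdeg, hx]
    simp
  refine ⟨le_antisymm ?_ (iSup_le fun n => inf_le_left), ?_⟩
  · intro x hx
    obtain ⟨s, hs, hmem⟩ := exists_sum_proj A x
    rw [hs]
    exact Submodule.sum_mem _ fun n _ => Submodule.mem_iSup_of_mem n ⟨hker x hx n, hmem n⟩
  · have hinj : ∀ {v : ι → Tilde A}, (LinearIndependent K fun i => π (v i)) →
        ∀ x ∈ Submodule.span K (Set.range v), π x = 0 → x = 0 := by
      intro v hv x hx hπx
      obtain ⟨c, rfl⟩ := (Finsupp.mem_span_range_iff_exists_finsupp).1 hx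
      have hc : c = 0 := by
        refine linearIndependent_iff.1 hv c ?_
        rw [Finsupp.linearCombination_apply, ← hπx, Finsupp.sum, Finsupp.sum, map_sum]
        simp
      simp [hc]
    rw [eq_bot_iff]
    rintro x ⟨hx, hxl⟩
    obtain ⟨y, hy, c, hc, rfl⟩ := Submodule.mem_sup.1 hxl
    obtain ⟨m, hm, z, hz, rfl⟩ := Submodule.mem_sup.1 hy
    obtain ⟨h0, h1, h2⟩ := component_local A
    have hcomp : ∀ n, π (proj A n (m + z + c)) = 0 := fun n => LieHom.mem_ker.1 (hker _ hx n)
    have e0 := hcomp 0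
    have e1 := hcomp 1
    have e2 := hcomp (-1)
    simp only [map_add (proj A _), proj_of_mem A hm, proj_of_mem A hz, proj_of_mem A hc] at e0 e1 e2
    norm_num at e0 e1 e2
    rw [Submodule.mem_bot, hinj hf m (h2 hm) e2, hinj hh z (h0 hz) e0, hinj he c (h1 hc) e1]
    simp

/-- A graded surjection onto a simple Lie algebra, injective on the local part, has the kernel
`J(A)`: the image of `J(A)` is an ideal, and not everything because `J(A)` would then contain `e_i`.
-/
theorem radical_eq_ker (hker : π.ker ∈ admissibleIdeals A) (hsurj : Function.Surjective π)
    (hL : ∀ I : LieIdeal K L, I = ⊥ ∨ I = ⊤) (i : ι) (hi : π (Tilde.gen A (Gen.e i)) ≠ 0) :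
    radical A = π.ker := by
  have hle : π.ker ≤ radical A := le_sSup hker
  refine le_antisymm ?_ hle
  rcases hL ((radical A).map π) with h | h
  · exact LieIdeal.map_eq_bot_iff.1 h
  · exfalso
    obtain ⟨r, hr⟩ := LieIdeal.mem_map_of_surjective hsurj
      (h ▸ LieSubmodule.mem_top (π (Tilde.gen A (Gen.e i))) :
        π (Tilde.gen A (Gen.e i)) ∈ (radical A).map π)
    have hmem : Tilde.gen A (Gen.e i) ∈ radical A := by
      have h1 : Tilde.gen A (Gen.e i) - r ∈ radical A := hle (by
        rw [LieHom.mem_ker, map_sub, hr, sub_self])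
      simpa using add_mem h1 r.2
    have hloc : Tilde.gen A (Gen.e i) ∈ localPart A :=
      Submodule.mem_sup_right (Submodule.subset_span (.e i))
    have h0 : Tilde.gen A (Gen.e i) ∈ (radical A).toSubmodule ⊓ localPart A := ⟨hmem, hloc⟩
    rw [(radical_isGreatest A).1.2, Submodule.mem_bot] at h0
    exact hi (by rw [h0, map_zero])

/-- If `J(A)` is the kernel of a surjection onto `L`, then `L` is isomorphic to `G(A)`. -/
theorem exists_lieEquiv (hrad : radical A = π.ker) (hsurj : Function.Surjective π) :
    ∃ φ : G A ≃ₗ⁅K⁆ L, ∀ x, φ (gen A x) = π (Tilde.gen A x) := by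
  let ψ : G A →ₗ⁅K⁆ L :=
    { (radical A).toSubmodule.liftQ (π : Tilde A →ₗ[K] L)
        (fun x hx => LinearMap.mem_ker.2 (LieHom.mem_ker.1 (hrad ▸ hx : x ∈ π.ker))) with
      map_lie' := by
        intro x y
        obtain ⟨x, rfl⟩ := LieSubmodule.Quotient.surjective_mk' (radical A) x
        obtain ⟨y, rfl⟩ := LieSubmodule.Quotient.surjective_mk' (radical A) y
        exact LieHom.map_lie π x y }
  have hψ : Function.Bijective ψ := by
    constructor
    · rw [injective_iff_map_eq_zero]
      intro x hx
      obtain ⟨x, rfl⟩ := LieSubmodule.Quotient.surjective_mk' (radical A) x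
      have h : π x = 0 := hx
      exact (LieSubmodule.Quotient.mk_eq_zero (radical A)).2 (hrad ▸ LieHom.mem_ker.2 h)
    · intro y
      obtain ⟨x, rfl⟩ := hsurj y
      exact ⟨LieSubmodule.Quotient.mk' (radical A) x, rfl⟩
  exact ⟨LieEquiv.ofBijective ψ hψ, fun x => rfl⟩

end Radical

end Contragredient

/-! ### Identification of the contragredient algebra -/

namespace WeisfeilerKac

open Module

open Contragredient

section Presentation

theorem table_eIndex_fIndex_of_ne : ∀ i j, i ≠ j → table (eIndex i) (fIndex j) = [] := by
  decide +kernel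

theorem eIndex_injective : Function.Injective eIndex := by decide +kernel

theorem fIndex_injective : Function.Injective fIndex := by decide +kernel

/-- The degree of a basis vector in the `ℤ`-grading with `deg e_i = 1`, `deg f_i = -1`. -/
def degree (i : Fin 34) : ℤ :=
  if (i : ℕ) < 4 then 0 else if (i : ℕ) % 2 = 0 then height i else -height i

theorem degree_table : ∀ i j, ∀ p ∈ table i j, degree p.2 = degree i + degree j := by
  decide +kernel

theorem degree_gens : ∀ k, degree (eIndex k) = 1 ∧ degree (fIndex k) = -1 ∧
    degree (torusIndex k) = 0 := by
  decide +kernel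

/-- The coordinates of the `h_i` in the toral basis vectors `h₁, (h₂ + h₄) / a, h₃, h₄`. -/
def corootMatrix {K : Type*} [Field K] (a : K) : Matrix (Fin 4) (Fin 4) K :=
  !![1, 0, 0, 0; 0, a, 0, 1; 0, 0, 1, 0; 0, 0, 0, 1]

variable {K g : Type*} [Field K] [LieRing g] [LieAlgebra K g] {a : K} {b : Basis (Fin 34) K g}

variable (a b) in
/-- The elements that play the role of the generators. -/
noncomputable def genVector : Gen (Fin 4) → g
  | Gen.e i => b (eIndex i)
  | Gen.f i => b (fIndex i)
  | Gen.h i => ∑ k, corootMatrix a i k • b (torusIndex k)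

theorem repr_lie_eq_zero (hb : IsTableBasis a b) {m n : ℤ} {x y : g}
    (hx : ∀ i, degree i ≠ m → b.repr x i = 0) (hy : ∀ i, degree i ≠ n → b.repr y i = 0)
    (k : Fin 34) (hk : degree k ≠ m + n) : b.repr ⁅x, y⁆ k = 0 := by
  have hval : ∀ l : List (ℕ × Fin 34), (∀ p ∈ l, p.2 ≠ k) → b.repr (value a b l) k = 0 := by
    intro l hl
    induction l with
    | nil => simp
    | cons p l ih =>
      rw [value_cons, map_add, Finsupp.add_apply, ih fun q hq => hl q (List.mem_cons_of_mem _ hq),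
        map_smul, Basis.repr_self, Finsupp.smul_apply,
        Finsupp.single_eq_of_ne (hl p List.mem_cons_self).symm, smul_zero, add_zero]
  rw [← b.sum_repr x, ← b.sum_repr y, sum_lie]
  simp only [lie_sum, smul_lie, lie_smul, map_sum, map_smul, Finsupp.coe_finsetSum,
    Finset.sum_apply, Finsupp.smul_apply, smul_eq_mul]
  refine Finset.sum_eq_zero fun i _ => Finset.sum_eq_zero fun j _ => ?_
  by_cases hi : degree i = m
  · by_cases hj : degree j = n
    · rw [hb, hval _ fun p hp hpk => hk (by rw [← hpk, degree_table i j p hp, hi, hj])]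
      simp
    · rw [hy j hj]; simp
  · rw [hx i hi]; simp

theorem linearIndependent_genVector_h (ha : a ≠ 0) :
    LinearIndependent K fun i => genVector a b (Gen.h i) := by
  rw [Fintype.linearIndependent_iff]
  intro c hc
  have hT : LinearIndependent K fun k => b (torusIndex k) :=
    b.linearIndependent.comp _ torusIndex_injective
  have h : ∑ k, (Matrix.vecMul c (corootMatrix a)) k • b (torusIndex k) = 0 := by
    rw [← hc]
    simp only [genVector, Matrix.vecMul, dotProduct, Finset.sum_smul, Finset.smul_sum, smul_smul]
    exact Finset.sum_comm
  have h' := Fintype.linearIndependent_iff.1 hT _ h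
  have h0 := h' 0
  have h1 := h' 1
  have h2 := h' 2
  have h3 := h' 3
  simp [Matrix.vecMul, dotProduct, Fin.sum_univ_four, corootMatrix] at h0 h1 h2 h3
  have h1' : c 1 = 0 := h1.resolve_right ha
  rw [h1', zero_add] at h3
  intro i
  fin_cases i <;> assumption

variable [CharP K 2]

theorem lift_genVector_eq_zero (hb : IsTableBasis a b) (x : FreeLieAlgebra K (Gen (Fin 4)))
    (hx : IsRelator (F4 a) x) : FreeLieAlgebra.lift K (genVector a b) x = 0 := by
  have h2 : ∀ z : g, z + z = 0 := fun z => by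
    rw [← two_smul K, CharTwo.two_eq_zero, zero_smul]
  have htorus : ∀ (i : Fin 4) (m : Fin 34),
      ⁅∑ k, corootMatrix a i k • b (torusIndex k), b m⁆ =
        (∑ k, corootMatrix a i k * castF2 K (weightVec m k)) • b m := by
    intro i m
    simp only [sum_lie, smul_lie, lie_torus hb, smul_smul, Finset.sum_smul]
  have hcartan : ∀ i j, ∑ k, corootMatrix a i k * castF2 K (weightVec (eIndex j) k) =
      F4 a i j := by
    intro i j
    rw [weightVec_eIndex]
    fin_cases i <;> fin_cases j <;>
      simp [Fin.sum_univ_four, corootMatrix, F4, CharTwo.add_self_eq_zero]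
  cases hx with
  | ef i j =>
    rw [map_sub, LieHom.map_lie, FreeLieAlgebra.lift_of_apply, FreeLieAlgebra.lift_of_apply,
      sub_eq_zero]
    simp only [genVector]
    rw [hb]
    split_ifs with hij
    · subst hij
      rw [FreeLieAlgebra.lift_of_apply, table_eIndex_fIndex]
      fin_cases i <;> simp [genVector, Fin.sum_univ_four, corootMatrix, torusIndex]
    · rw [table_eIndex_fIndex_of_ne i j hij, map_zero, value_nil]
  | hh i j =>
    rw [LieHom.map_lie, FreeLieAlgebra.lift_of_apply, FreeLieAlgebra.lift_of_apply]
    simp only [genVector]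
    rw [lie_sum]
    refine Finset.sum_eq_zero fun k _ => ?_
    rw [lie_smul, htorus, weightVec_torusIndex]
    simp
  | he i j =>
    rw [map_sub, LieHom.map_lie, map_smul, FreeLieAlgebra.lift_of_apply,
      FreeLieAlgebra.lift_of_apply]
    simp only [genVector]
    rw [htorus, hcartan, sub_self]
  | hf i j =>
    rw [map_add, LieHom.map_lie, map_smul, FreeLieAlgebra.lift_of_apply,
      FreeLieAlgebra.lift_of_apply]
    simp only [genVector]
    rw [htorus, weightVec_fIndex, hcartan, h2]

/-- The algebra `G(F_{4,a})` has a basis with the brackets of `table`: it is isomorphic to `Model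
a`. -/
theorem exists_isTableBasis (ha : a ≠ 0) (ha1 : a ≠ 1) :
    ∃ b : Basis (Fin 34) K (G (F4 a)), IsTableBasis a b ∧
      ∀ x, gen (F4 a) x = genVector a b x := by
  set β := Model.basis a
  have hβ : IsTableBasis a β := Model.isTableBasis a
  let π : Tilde (F4 a) →ₗ⁅K⁆ Model a := Tilde.lift (genVector a β) (lift_genVector_eq_zero hβ)
  have hπ : ∀ x, π (Tilde.gen (F4 a) x) = genVector a β x := Tilde.lift_gen _ _
  have hsurj : Function.Surjective π := by
    have h : π.range = ⊤ := eq_top_of_gens_mem hβ ha π.range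
      (fun k => (LieHom.mem_range π _).2 ⟨_, hπ (Gen.e k)⟩)
      (fun k => (LieHom.mem_range π _).2 ⟨_, hπ (Gen.f k)⟩)
    exact fun y => (LieHom.mem_range π y).1 (h ▸ LieSubalgebra.mem_top y)
  have hdeg : ∀ n x, IsMonomial (F4 a) n x → ∀ k, degree k ≠ n → β.repr (π x) k = 0 := by
    intro n x hx
    induction hx with
    | e i =>
      intro k hk
      rw [hπ, genVector, Basis.repr_self, Finsupp.single_eq_of_ne]
      rintro rfl
      exact hk (degree_gens i).1
    | f i =>
      intro k hk
      rw [hπ, genVector, Basis.repr_self, Finsupp.single_eq_of_ne]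
      rintro rfl
      exact hk (degree_gens i).2.1
    | h i =>
      intro k hk
      rw [hπ, genVector, map_sum, Finsupp.coe_finsetSum, Finset.sum_apply]
      refine Finset.sum_eq_zero fun l _ => ?_
      rw [map_smul, Basis.repr_self, Finsupp.smul_apply, Finsupp.single_eq_of_ne, smul_zero]
      rintro rfl
      exact hk (degree_gens l).2.2
    | lie _ _ hx hy =>
      rw [LieHom.map_lie]
      exact repr_lie_eq_zero hβ hx hy
  have hker : π.ker ∈ admissibleIdeals (F4 a) := by
    refine ker_mem_admissibleIdeals π β degree hdeg ?_ ?_ ?_ <;> simp only [hπ]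
    · exact β.linearIndependent.comp _ eIndex_injective
    · exact β.linearIndependent.comp _ fIndex_injective
    · exact linearIndependent_genVector_h ha
  have hrad := radical_eq_ker π hker hsurj (isSimple hβ ha ha1).eq_bot_or_eq_top 0 (by
    rw [hπ]; exact β.ne_zero _)
  obtain ⟨φ, hφ⟩ := exists_lieEquiv π hrad hsurj
  refine ⟨β.map φ.symm.toLinearEquiv, fun i j => ?_, fun x => ?_⟩
  · have h := congrArg φ.symm (hβ i j)
    rw [LieEquiv.map_lie] at h
    refine h.trans ?_
    exact map_value a β (φ.symm.toLinearEquiv : Model a →ₗ[K] G (F4 a)) _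
  · rw [← φ.symm_apply_apply (gen (F4 a) x), hφ, hπ]
    cases x with
    | e i => rfl
    | f i => rfl
    | h i =>
      have h := map_sum (φ.symm.toLinearEquiv : Model a →ₗ[K] G (F4 a))
        (fun k => corootMatrix a i k • β (torusIndex k)) Finset.univ
      simp only [map_smul] at h
      exact h

end Presentation

end WeisfeilerKac

/-! ### The Cartan subalgebra and its weights -/

namespace WeisfeilerKac

open Module

open Contragredient

section Cartan

variable {K g : Type*} [Field K] [LieRing g] [LieAlgebra K g] {a : K} {b : Basis (Fin 34) K g}

theorem mem_span_torus {x : g} : x ∈ Submodule.span K (Set.range fun k => b (torusIndex k)) ↔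
    ∀ i, weightVec i ≠ 0 → b.repr x i = 0 := by
  constructor
  · intro hx i hi
    obtain ⟨c, rfl⟩ := (Submodule.mem_span_range_iff_exists_fun K).1 hx
    rw [map_sum, Finsupp.coe_finsetSum, Finset.sum_apply]
    refine Finset.sum_eq_zero fun k _ => ?_
    rw [map_smul, Basis.repr_self, Finsupp.smul_apply, Finsupp.single_eq_of_ne, smul_zero]
    rintro rfl
    exact hi (weightVec_torusIndex k)
  · intro hx
    rw [eq_sum_torus hx]
    exact Submodule.sum_mem _ fun k _ => Submodule.smul_mem _ _ (Submodule.subset_span ⟨k, rfl⟩)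

variable [CharP K 2] {H : LieSubalgebra K g}

theorem lie_eq_zero_of_mem_torus (hb : IsTableBasis a b)
    (hH : H.toSubmodule = Submodule.span K (Set.range fun k => b (torusIndex k))) {x y : g}
    (hx : x ∈ H) (hy : y ∈ H) : ⁅x, y⁆ = 0 := by
  have hx' : x ∈ H.toSubmodule := hx
  rw [hH] at hx'
  obtain ⟨c, rfl⟩ := (Submodule.mem_span_range_iff_exists_fun K).1 hx'
  have hy' : y ∈ H.toSubmodule := hy
  rw [hH, mem_span_torus] at hy'
  refine b.repr.injective (Finsupp.ext fun i => ?_)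
  rw [repr_lie_sum_torus hb, map_zero, Finsupp.zero_apply]
  by_cases hi : weightVec i = 0
  · simp [hi]
  · rw [hy' i hi, mul_zero]

theorem isCartanSubalgebra (hb : IsTableBasis a b)
    (hH : H.toSubmodule = Submodule.span K (Set.range fun k => b (torusIndex k))) :
    H.IsCartanSubalgebra where
  nilpotent := by
    have : IsLieAbelian H := ⟨fun x y => Subtype.ext (lie_eq_zero_of_mem_torus hb hH x.2 y.2)⟩
    infer_instance
  self_normalizing := by
    refine le_antisymm (fun x hx => ?_) H.le_normalizer
    rw [LieSubalgebra.mem_normalizer_iff'] at hx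
    change x ∈ H.toSubmodule
    rw [hH, mem_span_torus]
    intro i hi
    obtain ⟨k, hk⟩ := Function.ne_iff.1 hi
    have hkH : b (torusIndex k) ∈ H.toSubmodule := hH ▸ Submodule.subset_span ⟨k, rfl⟩
    have h : ⁅b (torusIndex k), x⁆ ∈ H.toSubmodule := hx _ hkH
    rw [hH, mem_span_torus] at h
    have h' := h i hi
    rw [repr_lie_torus hb] at h'
    exact (mul_eq_zero.1 h').resolve_left fun h0 => hk ((map_eq_zero (castF2 K)).1 h0)

variable {P : g → g}

/-- Every `2`-map fixes the toral basis vectors, because the center is trivial. -/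
theorem twoMap_torus (hb : IsTableBasis a b) (ha : a ≠ 0) (ha1 : a ≠ 1) (hP : IsTwoMap K P)
    (k : Fin 4) : P (b (torusIndex k)) = b (torusIndex k) := by
  have hs := isSimple hb ha ha1
  have hinj : ∀ z : g, (∀ y : g, ⁅z, y⁆ = 0) → z = 0 := by
    intro z hz
    have hc : z ∈ LieAlgebra.center K g := by
      rw [LieModule.mem_maxTrivSubmodule]
      intro y
      rw [← lie_skew, hz, neg_zero]
    rcases hs.eq_bot_or_eq_top (LieAlgebra.center K g) with h | h
    · rwa [h, LieSubmodule.mem_bot] at hc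
    · exact absurd ((LieAlgebra.isLieAbelian_iff_center_eq_top K g).2 h) hs.non_abelian
  refine sub_eq_zero.1 (hinj _ fun y => ?_)
  have hy : ⁅P (b (torusIndex k)), y⁆ = ⁅b (torusIndex k), ⁅b (torusIndex k), y⁆⁆ := by
    rw [← LieAlgebra.ad_apply K g, hP.ad_map, sq]
    rfl
  rw [sub_lie, hy, sub_eq_zero]
  refine b.repr.injective (Finsupp.ext fun i => ?_)
  rw [repr_lie_torus hb, repr_lie_torus hb, ← mul_assoc, ← map_mul]
  congr 2
  generalize weightVec i k = z
  revert z
  decide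

theorem twoMap_sum_torus (hb : IsTableBasis a b) (ha : a ≠ 0) (ha1 : a ≠ 1) (hP : IsTwoMap K P)
    (c : Fin 4 → K) : P (∑ k, c k • b (torusIndex k)) = ∑ k, c k ^ 2 • b (torusIndex k) := by
  classical
  generalize (Finset.univ : Finset (Fin 4)) = s
  induction s using Finset.induction_on with
  | empty => simpa using hP.map_zero
  | insert k s hk ih =>
    have h0 : ⁅b (torusIndex k), ∑ l ∈ s, c l • b (torusIndex l)⁆ = 0 := by
      rw [lie_sum]
      refine Finset.sum_eq_zero fun l _ => ?_
      rw [lie_smul, lie_torus hb, weightVec_torusIndex]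
      simp
    rw [Finset.sum_insert hk, Finset.sum_insert hk, hP.map_add, ih, hP.map_smul,
      twoMap_torus hb ha ha1 hP, smul_lie, h0, smul_zero, add_zero]

theorem toralPart_eq (hb : IsTableBasis a b) (ha : a ≠ 0) (ha1 : a ≠ 1) (hP : IsTwoMap K P)
    (hH : H.toSubmodule = Submodule.span K (Set.range fun k => b (torusIndex k))) :
    toralPart P H = H := by
  refine le_antisymm (LieSubalgebra.lieSpan_le.2 fun t ht => ht.1) ?_
  rw [← LieSubalgebra.toSubmodule_le_toSubmodule, hH, Submodule.span_le]
  rintro _ ⟨k, rfl⟩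
  refine LieSubalgebra.subset_lieSpan ⟨?_, twoMap_torus hb ha ha1 hP k⟩
  change b (torusIndex k) ∈ H.toSubmodule
  rw [hH]
  exact Submodule.subset_span ⟨k, rfl⟩

theorem isTorus [IsAlgClosed K] (hb : IsTableBasis a b) (ha : a ≠ 0) (ha1 : a ≠ 1)
    (hP : IsTwoMap K P)
    (hH : H.toSubmodule = Submodule.span K (Set.range fun k => b (torusIndex k))) :
    IsTorus P H := by
  have hmem : ∀ c : Fin 4 → K, ∑ k, c k • b (torusIndex k) ∈ H := fun c => by
    change _ ∈ H.toSubmodule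
    rw [hH]
    exact (Submodule.mem_span_range_iff_exists_fun K).2 ⟨c, rfl⟩
  have hex : ∀ x ∈ H, ∃ c : Fin 4 → K, ∑ k, c k • b (torusIndex k) = x := fun x hx => by
    have hx' : x ∈ H.toSubmodule := hx
    rw [hH] at hx'
    exact (Submodule.mem_span_range_iff_exists_fun K).1 hx'
  have hmaps : Set.MapsTo P H H := fun x hx => by
    obtain ⟨c, rfl⟩ := hex x hx
    rw [twoMap_sum_torus hb ha ha1 hP]
    exact hmem _
  refine ⟨hmaps, fun x hx y hy hxy => ?_, fun x hx => ?_⟩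
  · have hsub : P (x - y) = 0 := by
      rw [sub_eq_add_neg, ← neg_one_smul K y, CharTwo.neg_eq, one_smul, hP.map_add, hxy,
        lie_eq_zero_of_mem_torus hb hH hx hy, add_zero, ← two_smul K, CharTwo.two_eq_zero,
        zero_smul]
    obtain ⟨c, hc⟩ := hex (x - y) (H.sub_mem hx hy)
    rw [← hc, twoMap_sum_torus hb ha ha1 hP] at hsub
    have h0 := Fintype.linearIndependent_iff.1
      (b.linearIndependent.comp _ torusIndex_injective) _ hsub
    rw [← sub_eq_zero, ← hc]
    exact Finset.sum_eq_zero fun k _ => by rw [pow_eq_zero_iff two_ne_zero |>.1 (h0 k), zero_smul]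
  · obtain ⟨c, rfl⟩ := hex x hx
    choose d hd using fun k => exists_sq_eq (c k)
    exact ⟨_, hmem d, by simp only [twoMap_sum_torus hb ha ha1 hP, hd]⟩

/-- A torus element on which no nonzero weight vanishes has the torus as its centralizer. -/
theorem exists_finrank_ker_ad_le [IsAlgClosed K] (hb : IsTableBasis a b) :
    ∃ y : g, finrank K (LinearMap.ker (LieAlgebra.ad K g y : g →ₗ[K] g)) ≤ 4 := by
  let v : {ε : Fin 4 → ZMod 2 // ε ≠ 0} → Fin 4 → K := fun ε k => castF2 K (ε.1 k)
  obtain ⟨f, hf⟩ := Module.exists_dual_forall_apply_ne_zero (K := K) v fun ε h => ε.2 (by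
    funext k
    exact (map_eq_zero (castF2 K)).1 (congrFun h k))
  have hfv : ∀ ε, f (v ε) = ∑ k, f (Pi.single k 1) * v ε k := by
    intro ε
    conv_lhs => rw [pi_eq_sum_univ' (v ε)]
    rw [map_sum]
    refine Finset.sum_congr rfl fun k _ => ?_
    rw [map_smul, smul_eq_mul, mul_comm]
  refine ⟨∑ k, f (Pi.single k 1) • b (torusIndex k), ?_⟩
  have hle : LinearMap.ker (LieAlgebra.ad K g (∑ k, f (Pi.single k 1) • b (torusIndex k)) :
      g →ₗ[K] g) ≤ Submodule.span K (Set.range fun k => b (torusIndex k)) := by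
    intro x hx
    rw [mem_span_torus]
    intro i hi
    have h := repr_lie_sum_torus hb (fun k => f (Pi.single k 1)) x i
    have hx' : ⁅∑ k, f (Pi.single k 1) • b (torusIndex k), x⁆ = 0 := hx
    rw [hx', map_zero, Finsupp.zero_apply, eq_comm] at h
    exact (mul_eq_zero.1 h).resolve_left fun h0 => hf ⟨weightVec i, hi⟩ ((hfv _).trans h0)
  have hfin : FiniteDimensional K g := Module.Finite.of_basis b
  refine (Submodule.finrank_mono hle).trans ?_
  exact (finrank_range_le_card fun k => b (torusIndex k)).trans (by simp)

end Cartan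

section Weights

variable {K g : Type*} [Field K] [CharP K 2] [LieRing g] [LieAlgebra K g] {a : K}
  {b : Basis (Fin 34) K g} {T : LieSubalgebra K g}

omit [CharP K 2] in
theorem exists_torus_basis
    (hT : T.toSubmodule = Submodule.span K (Set.range fun k => b (torusIndex k))) :
    ∃ t : Basis (Fin 4) K T, ∀ k, (t k : g) = b (torusIndex k) := by
  have hli : LinearIndependent K fun k => b (torusIndex k) :=
    b.linearIndependent.comp _ torusIndex_injective
  refine ⟨(Basis.span hli).map (LinearEquiv.ofEq _ _ hT.symm), fun k => ?_⟩
  rw [Basis.map_apply]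
  exact congrArg Subtype.val (Basis.span_apply hli k)

variable (t : Basis (Fin 4) K T)

/-- The homomorphism from `𝔽₂⁴` to the dual of the torus which sends `ε` to the functional with the
values `ε` on the basis `t`. Its image is the group of weights. -/
noncomputable def weightHom : (Fin 4 → ZMod 2) →+ Module.Dual K T where
  toFun ε := ∑ k, castF2 K (ε k) • t.coord k
  map_zero' := by simp
  map_add' ε δ := by simp only [Pi.add_apply, map_add, add_smul, Finset.sum_add_distrib]

theorem weightHom_apply_basis (ε : Fin 4 → ZMod 2) (k : Fin 4) :
    weightHom t ε (t k) = castF2 K (ε k) := by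
  simp [weightHom, Finsupp.single_apply]

theorem weightHom_injective : Function.Injective (weightHom t) := by
  intro ε δ h
  funext k
  apply (castF2 K).injective
  rw [← weightHom_apply_basis t, h, weightHom_apply_basis]

theorem closure_coord_eq_range :
    AddSubgroup.closure (Set.range t.coord) = (weightHom t).range := by
  refine le_antisymm ((AddSubgroup.closure_le _).2 ?_) ?_
  · rintro _ ⟨k, rfl⟩
    refine ⟨Pi.single k 1, t.ext fun l => ?_⟩
    rw [weightHom_apply_basis, Basis.coord_apply, Basis.repr_self, Pi.single_apply,
      Finsupp.single_apply]
    by_cases h : l = k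
    · simp [h]
    · simp [h]
  · rintro _ ⟨ε, rfl⟩
    change ∑ k, castF2 K (ε k) • t.coord k ∈ _
    refine sum_mem fun k _ => ?_
    have hε : ∀ z : ZMod 2, z = 0 ∨ z = 1 := by decide
    rcases hε (ε k) with h | h <;> rw [h]
    · rw [map_zero, zero_smul]; exact AddSubgroup.zero_mem _
    · rw [map_one, one_smul]; exact AddSubgroup.subset_closure ⟨k, rfl⟩

variable {t}

theorem mem_weightSubspace (hb : IsTableBasis a b) (ht : ∀ k, (t k : g) = b (torusIndex k))
    (ξ : Module.Dual K T) (x : g) :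
    x ∈ weightSubspace T ξ ↔ ∀ i, b.repr x i ≠ 0 → weightHom t (weightVec i) = ξ := by
  constructor
  · intro hx i hi
    refine t.ext fun k => ?_
    have h := repr_lie_torus hb k x i
    have hx' : ⁅(t k : g), x⁆ = ξ (t k) • x := hx (t k)
    rw [← ht, hx', map_smul, Finsupp.smul_apply, smul_eq_mul] at h
    rw [weightHom_apply_basis]
    exact (mul_right_cancel₀ hi h).symm
  · intro hx s
    let f : T →ₗ[K] g :=
      (LieAlgebra.ad K g : g →ₗ[K] Module.End K g).flip x ∘ₗ T.toSubmodule.subtype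
    have hf : f = ξ.smulRight x := by
      refine t.ext fun k => b.repr.injective (Finsupp.ext fun i => ?_)
      change b.repr ⁅(t k : g), x⁆ i = b.repr (ξ (t k) • x) i
      rw [ht, repr_lie_torus hb, map_smul, Finsupp.smul_apply, smul_eq_mul]
      by_cases hi : b.repr x i = 0
      · rw [hi, mul_zero, mul_zero]
      · rw [← hx i hi, weightHom_apply_basis]
    exact LinearMap.congr_fun hf s

theorem weightSubspace_eq_span (hb : IsTableBasis a b)
    (ht : ∀ k, (t k : g) = b (torusIndex k)) (ξ : Module.Dual K T) :
    weightSubspace T ξ = Submodule.span K (b '' {i | weightHom t (weightVec i) = ξ}) := by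
  ext x
  rw [mem_weightSubspace hb ht, Basis.mem_span_image]
  simp only [Set.subset_def, Finset.mem_coe, Finsupp.mem_support_iff, Set.mem_ofPred_eq]

theorem isCartanDecomposition (hb : IsTableBasis a b)
    (ht : ∀ k, (t k : g) = b (torusIndex k))
    (hT : T.toSubmodule = Submodule.span K (Set.range fun k => b (torusIndex k))) :
    IsCartanDecomposition T (AddSubgroup.closure (Set.range t.coord)) := by
  constructor
  · ext x
    rw [mem_weightSubspace hb ht, hT, mem_span_torus]
    refine forall_congr' fun i => ?_
    rw [not_imp_comm, ← map_zero (weightHom t), (weightHom_injective t).eq_iff]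
  · classical
    rw [DirectSum.isInternal_submodule_iff_iSupIndep_and_iSup_eq_top]
    simp only [weightSubspace_eq_span hb ht]
    constructor
    · intro ξ
      refine Disjoint.mono_right (iSup₂_le fun η hη => Submodule.span_mono
        (Set.image_mono (?_ : _ ⊆ {i | weightHom t (weightVec i) = ξ}ᶜ)))
        (b.linearIndependent.disjoint_span_image disjoint_compl_right)
      intro i hi hi'
      exact hη (Subtype.ext (hi.symm.trans hi'))
    · rw [eq_top_iff, ← b.span_eq, Submodule.span_le]
      rintro _ ⟨i, rfl⟩
      have hi : weightHom t (weightVec i) ∈ AddSubgroup.closure (Set.range t.coord) := by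
        rw [closure_coord_eq_range]
        exact ⟨_, rfl⟩
      exact Submodule.mem_iSup_of_mem ⟨_, hi⟩ (Submodule.subset_span ⟨i, rfl, rfl⟩)

theorem finrank_weightSubspace (hb : IsTableBasis a b)
    (ht : ∀ k, (t k : g) = b (torusIndex k)) {ξ : Module.Dual K T}
    (hξ : ξ ∈ AddSubgroup.closure (Set.range t.coord)) (hξ0 : ξ ≠ 0) :
    finrank K (weightSubspace T ξ) = 2 := by
  rw [closure_coord_eq_range] at hξ
  obtain ⟨ε, rfl⟩ := hξ
  have hε : ε ≠ 0 := fun h => hξ0 (by rw [h, map_zero])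
  have hset : {i | weightHom t (weightVec i) = weightHom t ε} =
      ((Finset.univ.filter fun i => weightVec i = ε : Finset (Fin 34)) : Set (Fin 34)) := by
    ext i
    simp [(weightHom_injective t).eq_iff]
  rw [weightSubspace_eq_span hb ht, hset, Set.image_eq_range]
  refine (finrank_span_eq_card (b.linearIndependent.comp _ Subtype.val_injective)).trans ?_
  simpa [Fintype.card_subtype] using card_weightVec_fiber ε hε

end Weights

end WeisfeilerKac

open WeisfeilerKac in
theorem theorem2 {K : Type*} [Field K] [IsAlgClosed K] [CharP K 2]
    (a : K) (ha0 : a ≠ 0) (ha1 : a ≠ 1) :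
    -- `G(F_{4,a})` is a simple Lie `2`-algebra of dimension `34`
    LieAlgebra.IsSimple K (Contragredient.G (Contragredient.F4 a)) ∧
    Module.finrank K (Contragredient.G (Contragredient.F4 a)) = 34 ∧
    (∃ P : Contragredient.G (Contragredient.F4 a) → Contragredient.G (Contragredient.F4 a),
      IsTwoMap K P) ∧
    (Contragredient.cartan (Contragredient.F4 a)).IsCartanSubalgebra ∧
    ∀ P : Contragredient.G (Contragredient.F4 a) → Contragredient.G (Contragredient.F4 a),
      IsTwoMap K P →
      -- its toral rank is `4`
      HasToralRank K P 4 ∧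
      -- `T(h)` is a torus of dimension `4`
      IsTorus P (toralPart P (Contragredient.cartan (Contragredient.F4 a))) ∧
      Module.finrank K (toralPart P (Contragredient.cartan (Contragredient.F4 a))) = 4 ∧
      -- the basis `h₁, (h₂ + h₄) / a, h₃, h₄` of `T(h)`, whose dual basis is `α, β, γ, λ`
      ∃ b : Module.Basis (Fin 4) K (toralPart P (Contragredient.cartan (Contragredient.F4 a))),
        (b 0 : Contragredient.G (Contragredient.F4 a)) =
          Contragredient.gen (Contragredient.F4 a) (Contragredient.Gen.h 0) ∧
        (b 1 : Contragredient.G (Contragredient.F4 a)) =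
          a⁻¹ • (Contragredient.gen (Contragredient.F4 a) (Contragredient.Gen.h 1) +
            Contragredient.gen (Contragredient.F4 a) (Contragredient.Gen.h 3)) ∧
        (b 2 : Contragredient.G (Contragredient.F4 a)) =
          Contragredient.gen (Contragredient.F4 a) (Contragredient.Gen.h 2) ∧
        (b 3 : Contragredient.G (Contragredient.F4 a)) =
          Contragredient.gen (Contragredient.F4 a) (Contragredient.Gen.h 3) ∧
        -- `⟨α, β, γ, λ⟩` is an elementary abelian group of order `16`, it indexes the Cartan
        -- decomposition, and all root spaces are of dimension `2`
        Nat.card (AddSubgroup.closure (Set.range b.coord)) = 16 ∧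
        (∀ ξ ∈ AddSubgroup.closure (Set.range b.coord), ξ + ξ = 0) ∧
        IsCartanDecomposition (toralPart P (Contragredient.cartan (Contragredient.F4 a)))
          (AddSubgroup.closure (Set.range b.coord)) ∧
        ∀ ξ ∈ AddSubgroup.closure (Set.range b.coord), ξ ≠ 0 →
          Module.finrank K (weightSubspace
            (toralPart P (Contragredient.cartan (Contragredient.F4 a))) ξ) = 2 := by
  obtain ⟨b, hb, hgen⟩ := exists_isTableBasis ha0 ha1
  have hfin : FiniteDimensional K (Contragredient.G (Contragredient.F4 a)) :=
    Module.Finite.of_basis b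
  have hh0 : Contragredient.gen (Contragredient.F4 a) (Contragredient.Gen.h 0) = b 0 := by
    simp [hgen, genVector, Fin.sum_univ_four, corootMatrix, torusIndex]
  have hh1 : Contragredient.gen (Contragredient.F4 a) (Contragredient.Gen.h 1) =
      a • b 1 + b 3 := by
    simp [hgen, genVector, Fin.sum_univ_four, corootMatrix, torusIndex]
  have hh2 : Contragredient.gen (Contragredient.F4 a) (Contragredient.Gen.h 2) = b 2 := by
    simp [hgen, genVector, Fin.sum_univ_four, corootMatrix, torusIndex]
  have hh3 : Contragredient.gen (Contragredient.F4 a) (Contragredient.Gen.h 3) = b 3 := by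
    simp [hgen, genVector, Fin.sum_univ_four, corootMatrix, torusIndex]
  have hb1 : b 1 = a⁻¹ • (Contragredient.gen (Contragredient.F4 a) (Contragredient.Gen.h 1) +
      Contragredient.gen (Contragredient.F4 a) (Contragredient.Gen.h 3)) := by
    rw [hh1, hh3, add_assoc, ← two_smul K (b 3), CharTwo.two_eq_zero, zero_smul, add_zero,
      inv_smul_smul₀ ha0]
  have hH : (Contragredient.cartan (Contragredient.F4 a)).toSubmodule =
      Submodule.span K (Set.range fun k => b (torusIndex k)) := by
    change Submodule.span K _ = _
    refine le_antisymm (Submodule.span_le.2 ?_) (Submodule.span_le.2 ?_)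
    · rintro _ ⟨i, rfl⟩
      dsimp only
      rw [hgen]
      exact Submodule.sum_mem _ fun k _ => Submodule.smul_mem _ _ (Submodule.subset_span ⟨k, rfl⟩)
    · have hmem : ∀ i, Contragredient.gen (Contragredient.F4 a) (Contragredient.Gen.h i) ∈
          Submodule.span K (Set.range fun i =>
            Contragredient.gen (Contragredient.F4 a) (Contragredient.Gen.h i)) :=
        fun i => Submodule.subset_span ⟨i, rfl⟩
      rintro _ ⟨k, rfl⟩
      fin_cases k
      · change b 0 ∈ _
        rw [← hh0]
        exact hmem 0
      · change b 1 ∈ _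
        rw [hb1]
        exact Submodule.smul_mem _ _ (Submodule.add_mem _ (hmem 1) (hmem 3))
      · change b 2 ∈ _
        rw [← hh2]
        exact hmem 2
      · change b 3 ∈ _
        rw [← hh3]
        exact hmem 3
  refine ⟨isSimple hb ha0 ha1, by rw [Module.finrank_eq_card_basis b, Fintype.card_fin],
    exists_isTwoMap hb, isCartanSubalgebra hb hH, fun P hP => ?_⟩
  rw [toralPart_eq hb ha0 ha1 hP hH]
  have hT := isTorus hb ha0 ha1 hP hH
  obtain ⟨t, ht⟩ := exists_torus_basis hH
  have hfour : Module.finrank K (Contragredient.cartan (Contragredient.F4 a)) = 4 := by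
    rw [Module.finrank_eq_card_basis t, Fintype.card_fin]
  refine ⟨⟨⟨_, hT, hfour⟩, ?_⟩, hT, hfour, t, (ht 0).trans hh0.symm, (ht 1).trans hb1,
    (ht 2).trans hh2.symm, (ht 3).trans hh3.symm, ?_, ?_, isCartanDecomposition hb ht hH,
    fun ξ => finrank_weightSubspace hb ht⟩
  · rintro d ⟨S, hS, rfl⟩
    obtain ⟨y, hy⟩ := exists_finrank_ker_ad_le hb
    exact (hS.finrank_le hP y).trans hy
  · rw [closure_coord_eq_range, Nat.card_congr
      (AddMonoidHom.ofInjective (weightHom_injective t)).symm.toEquiv]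
    simp
  · intro ξ _
    rw [← two_smul K, CharTwo.two_eq_zero, zero_smul]
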